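/- Let $(M,g)$ be a connected noncompact $C^\infty$ Riemannian manifold without boundary of dimension $n\ge 2$, with Riemannian distance $d$, all of whose geodesics (parametrized by arc length) are defined on $\mathbb{R}$. Let $SM$ be its unit tangent bundle, let $\Phi_t(v)=\dot\gamma_v(t)$ ($v\in SM$, $t\in\mathbb{R}$) be the geodesic flow, where $\gamma_v$ is the geodesic with $\dot\gamma_v(0)=v$, and let $\tilde d$ be the distance on $SM$ of the Riemannian metric induced on $SM\subset TM$ by the Sasaki metric $\langle\xi,\eta\rangle=g(d\pi\,\xi,d\pi\,\eta)+g(K\xi,K\eta)$, where $\pi:TM\to M$ is the projection and $K$ is the connection map of the Levi-Civita connection. Suppose that the geodesic flow is pointwise equicontinuous with respect to $\tilde d$: for every $v\in SM$ and $\varepsilon>0$ there is $\delta>0$ such that for all $w\in SM$ with $\tilde d(v,w)<\delta$ we have $\tilde d(\Phi_t(v),\Phi_t(w))<\varepsilon$ for all $t\in\mathbb{R}$. Then: 1. There is no line (minimal geodesic) in $M$, that is, no geodesic $\gamma:\mathbb{R}\to M$ with $d(\gamma(s),\gamma(t))=|s-t|$ for all $s,t\in\mathbb{R}$. 2. There is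 a function $C:M\to\mathbb{R}$, bounded above on every compact subset of $M$, such that for all $x\in M$ and all $r$ the metric sphere $\partial B(x,r)=\{y\in M : d(x,y)=r\}$ satisfies $\operatorname{diam}\partial B(x,r)=\sup\{d(y,z) : y,z\in\partial B(x,r)\}\le C(x)$. -/

import Mathlib

open Set Bundle Manifold MeasureTheory
open scoped ContDiff Topology ENNReal RealInnerProductSpace

noncomputable section

namespace RiemGeom

variable {n : ℕ} {M : Type*} [TopologicalSpace M] [ChartedSpace (EuclideanSpace ℝ (Fin n)) M]
  [IsManifold (𝓡 n) ∞ M] [RiemannianBundle (fun x : M => TangentSpace (𝓡 n) x)]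

/-- The matrix `g_{ij}(y)` of the Riemannian metric in the preferred chart `φ` around `p`, as a
bilinear form on the model space: `u, w ↦ g(dφ⁻¹ u, dφ⁻¹ w)` at the point `φ⁻¹ y`. -/
def chartMetric (n : ℕ) {M : Type*} [TopologicalSpace M]
    [ChartedSpace (EuclideanSpace ℝ (Fin n)) M] [IsManifold (𝓡 n) ∞ M]
    [RiemannianBundle (fun x : M => TangentSpace (𝓡 n) x)] (p : M)
    (y : EuclideanSpace ℝ (Fin n)) :
    EuclideanSpace ℝ (Fin n) →L[ℝ] EuclideanSpace ℝ (Fin n) →L[ℝ] ℝ :=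
  let q : M := (extChartAt (𝓡 n) p).symm y
  let A : EuclideanSpace ℝ (Fin n) →L[ℝ] TangentSpace (𝓡 n) q :=
    (trivializationAt (EuclideanSpace ℝ (Fin n)) (TangentSpace (𝓡 n)) p).symmL ℝ q
  (innerSL ℝ (E := TangentSpace (𝓡 n) q)).bilinearComp A A

/-- The linear form `w ↦ ½ (∂_u g(w, v) + ∂_v g(u, w) - ∂_w g(u, v))` at `p`, in the preferred chart
around `p` (Christoffel symbols of the first kind). -/
def koszulForm (n : ℕ) {M : Type*} [TopologicalSpace M]
    [ChartedSpace (EuclideanSpace ℝ (Fin n)) M] [IsManifold (𝓡 n) ∞ M]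
    [RiemannianBundle (fun x : M => TangentSpace (𝓡 n) x)] (p : M)
    (u v : EuclideanSpace ℝ (Fin n)) : EuclideanSpace ℝ (Fin n) →L[ℝ] ℝ :=
  let D := fderiv ℝ (chartMetric n p) (extChartAt (𝓡 n) p p)
  (1 / 2 : ℝ) • ((D u).flip v + D v u - (D.flip u).flip v)

/-- The Christoffel symbol `Γ(u, v) = Γ^k_{ij} uⁱ vʲ ∂_k` of the Levi-Civita connection at `p`, in
the preferred chart around `p`: the vector that represents `koszulForm n p u v` with respect to the
Riemannian inner product (in that chart `T_p M` is identified with the model space). -/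
def christoffel (p : M) (u v : TangentSpace (𝓡 n) p) : TangentSpace (𝓡 n) p :=
  haveI : FiniteDimensional ℝ (TangentSpace (𝓡 n) p) :=
    inferInstanceAs (FiniteDimensional ℝ (EuclideanSpace ℝ (Fin n)))
  haveI : CompleteSpace (TangentSpace (𝓡 n) p) := FiniteDimensional.complete ℝ _
  (InnerProductSpace.toDual ℝ (TangentSpace (𝓡 n) p)).symm (koszulForm n p u v)

/-- The connection map `K : T_v(TM) → T_{π v} M` of the Levi-Civita connection. A vector tangent
to `TM` at `v` is read in the preferred chart of `TM` at `v` as a pair `(a, b)`; then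
`K (a, b) = b + Γ(a, v)`. If `V` is a curve in `TM`, then `K (V')` is the covariant derivative of
the vector field `V` along its foot point curve. -/
def connectionMap (v : TangentBundle (𝓡 n) M) (ξ : TangentSpace (𝓡 n).tangent v) :
    TangentSpace (𝓡 n) v.proj :=
  let a : TangentSpace (𝓡 n) v.proj := ξ.1
  let b : TangentSpace (𝓡 n) v.proj := ξ.2
  b + christoffel v.proj a v.2

/-- The differential `dπ : T_v(TM) → T_{π v} M` of the canonical projection `π : TM → M`. -/
def dproj (v : TangentBundle (𝓡 n) M) (ξ : TangentSpace (𝓡 n).tangent v) :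
    TangentSpace (𝓡 n) v.proj :=
  mfderiv (𝓡 n).tangent (𝓡 n) (fun w : TangentBundle (𝓡 n) M => w.proj) v ξ

/-- The Sasaki metric on `TM`: `⟨ξ, η⟩ = g(dπ ξ, dπ η) + g(K ξ, K η)`. -/
def sasakiInner (v : TangentBundle (𝓡 n) M) (ξ η : TangentSpace (𝓡 n).tangent v) : ℝ :=
  inner ℝ (dproj v ξ) (dproj v η) + inner ℝ (connectionMap v ξ) (connectionMap v η)

/-- The norm of the Sasaki metric. -/
def sasakiNorm (v : TangentBundle (𝓡 n) M) (ξ : TangentSpace (𝓡 n).tangent v) : ℝ :=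
  √(sasakiInner v ξ ξ)

variable (n M) in
/-- The unit tangent bundle `SM`. -/
abbrev UnitTangentBundle : Type _ := {v : TangentBundle (𝓡 n) M // ‖v.2‖ = 1}

/-- The Sasaki length of a curve in `TM` defined on `[0, 1]`. -/
def sasakiLength (c : ℝ → TangentBundle (𝓡 n) M) : ℝ≥0∞ :=
  ∫⁻ t in Icc (0 : ℝ) 1,
    ENNReal.ofReal (sasakiNorm (c t) (mfderiv 𝓘(ℝ, ℝ) (𝓡 n).tangent c t (1 : ℝ)))

/-- The distance on `SM` of the Riemannian metric that the Sasaki metric induces on `SM`: the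
infimum of the Sasaki lengths of the `C¹` curves in `SM` from `v` to `w`. -/
def sasakiEDist (v w : UnitTangentBundle n M) : ℝ≥0∞ :=
  ⨅ (c : ℝ → TangentBundle (𝓡 n) M)
    (_ : ContMDiffOn 𝓘(ℝ, ℝ) (𝓡 n).tangent 1 c (Icc 0 1)
      ∧ (∀ t ∈ Icc (0 : ℝ) 1, ‖(c t).2‖ = 1) ∧ c 0 = v.1 ∧ c 1 = w.1),
    sasakiLength c

/-- The velocity of a curve in `M`, as a curve in `TM`. -/
def velocity (n : ℕ) {M : Type*} [TopologicalSpace M]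
    [ChartedSpace (EuclideanSpace ℝ (Fin n)) M] (γ : ℝ → M) (t : ℝ) : TangentBundle (𝓡 n) M :=
  ⟨γ t, mfderiv 𝓘(ℝ, ℝ) (𝓡 n) γ t (1 : ℝ)⟩

/-- Geodesics `γ : ℝ → M` parametrized by arc length: `γ` is smooth, `|γ'| = 1`, and the
covariant derivative of `γ'` along `γ` vanishes. -/
structure IsGeodesic (n : ℕ) {M : Type*} [TopologicalSpace M]
    [ChartedSpace (EuclideanSpace ℝ (Fin n)) M] [IsManifold (𝓡 n) ∞ M]
    [RiemannianBundle (fun x : M => TangentSpace (𝓡 n) x)] (γ : ℝ → M) : Prop where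
  smooth : ContMDiff 𝓘(ℝ, ℝ) (𝓡 n) ∞ γ
  unit_speed : ∀ t, ‖(velocity n γ t).2‖ = 1
  covDeriv_eq_zero : ∀ t, connectionMap (velocity n γ t)
    (mfderiv 𝓘(ℝ, ℝ) (𝓡 n).tangent (velocity n γ) t (1 : ℝ)) = 0

/-- `Φ` is the (complete) geodesic flow on `SM`: for each `v` there is a geodesic `γ_v : ℝ → M`
with `γ_v'(0) = v`, and `Φ_t(v) = γ_v'(t)`. Such a `Φ` is unique, and it exists if and only if `M`
is geodesically complete. -/
def IsGeodesicFlow (Φ : ℝ → UnitTangentBundle n M → UnitTangentBundle n M) : Prop :=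
  ∀ v : UnitTangentBundle n M, ∃ γ : ℝ → M,
    IsGeodesic n γ ∧ velocity n γ 0 = v.1 ∧ ∀ t, (Φ t v).1 = velocity n γ t

/-- A line (minimal geodesic): a geodesic `γ : ℝ → M` that realizes the distance between any two
of its points. -/
def IsLine (n : ℕ) {M : Type*} [MetricSpace M]
    [ChartedSpace (EuclideanSpace ℝ (Fin n)) M] [IsManifold (𝓡 n) ∞ M]
    [RiemannianBundle (fun x : M => TangentSpace (𝓡 n) x)] (γ : ℝ → M) : Prop :=
  IsGeodesic n γ ∧ ∀ s t : ℝ, dist (γ s) (γ t) = |s - t|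

/-- Pointwise equicontinuity of a system `(X, ℝ)` with respect to the distance `d`. -/
def PointwiseEquicontinuous {X : Type*} (d : X → X → ℝ≥0∞) (Φ : ℝ → X → X) : Prop :=
  ∀ x : X, ∀ ε > 0, ∃ δ > 0, ∀ y : X, d x y < δ → ∀ t : ℝ, d (Φ t x) (Φ t y) < ε

end RiemGeom

end

/-! Equicontinuity is converted into a bound on metric spheres. For unit vectors v, w let D(v, w) be
the supremum over t of d(π Φ_t v, π Φ_t w), a pseudodistance that might be infinite. The projection
π : SM → M does not increase distances (`edist_proj_le_sasakiEDist`), so equicontinuity with ε = 1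
gives D(v, w) ≤ 1 for all w near v. The unit vectors at points near p lie in a continuous image of
(closed coordinate ball) × (unit sphere), which is compact, and connected because n ≥ 2. A locally
bounded pseudodistance on such a space is bounded (`exists_le_of_eventually_le`). Hence orbits of
unit vectors with a common foot point x stay within a distance C of each other, with the same C for
all x near p (`exists_edist_flow_le`). By Hopf–Rinow every point of ∂B(x, r), r > 0, is π Φ_r v for
some unit vector v at x, so diam ∂B(x, r) ≤ C for every r. A line γ would put γ(r) and γ(-r), which
are 2r apart, on ∂B(γ(0), r); this is impossible for large r.

Two ingredients take most of the work. One is that the Sasaki distance is small on small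
neighbourhoods in SM (`eventually_sasakiEDist_lt`); it rests on the formula for the connection map
in an arbitrary chart (`connectionMap_coord`).

The other is Hopf–Rinow (`exists_minimal_geodesic`). Its local part (`exists_local_direction`) never
differentiates the exponential map. The geodesic flow is Lipschitz in the initial velocity, and the
first variation formula holds with a quadratic error; together they show that the squared length of
radial geodesics is differentiable and satisfies the eikonal inequality (`exists_local_distance`).
So no path is shorter than the radial geodesic. Globally a minimal geodesic is prolonged by short
minimal pieces, which join without a corner (`IsGeodesic.velocity_eq_of_minimal`). -/

noncomputable section

namespace RiemGeom

set_option synthInstance.maxHeartbeats 400000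
set_option linter.unusedSectionVars false

/-! ### Tangent vectors and the metric in a chart -/

section ChartMetric

variable {n : ℕ} {M : Type*} [TopologicalSpace M] [ChartedSpace (EuclideanSpace ℝ (Fin n)) M]
  [IsManifold (𝓡 n) ∞ M]

/-- The components of a tangent vector in the preferred chart around `p`. -/
def tangentCoord (p : M) (V : TangentBundle (𝓡 n) M) : EuclideanSpace ℝ (Fin n) :=
  (trivializationAt (EuclideanSpace ℝ (Fin n)) (TangentSpace (𝓡 n)) p V).2

/-- The tangent vector with components `u` at the point with coordinates `y` in the preferred chart
around `p`. -/
def ofCoord (p : M) (y u : EuclideanSpace ℝ (Fin n)) : TangentBundle (𝓡 n) M :=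
  ⟨(extChartAt (𝓡 n) p).symm y,
    (trivializationAt (EuclideanSpace ℝ (Fin n)) (TangentSpace (𝓡 n)) p).symmL ℝ
      ((extChartAt (𝓡 n) p).symm y) u⟩

omit [IsManifold (𝓡 n) ∞ M] in
theorem extChartAt_symm_mem {p : M} {y : EuclideanSpace ℝ (Fin n)}
    (hy : y ∈ (extChartAt (𝓡 n) p).target) :
    (extChartAt (𝓡 n) p).symm y ∈ (chartAt (EuclideanSpace ℝ (Fin n)) p).source := by
  simpa using (extChartAt (𝓡 n) p).map_target hy

theorem tangentCoord_symmL {p q : M} (hq : q ∈ (chartAt (EuclideanSpace ℝ (Fin n)) p).source)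
    (u : EuclideanSpace ℝ (Fin n)) :
    tangentCoord p ⟨q, (trivializationAt (EuclideanSpace ℝ (Fin n)) (TangentSpace (𝓡 n)) p).symmL ℝ
      q u⟩ = u := by
  unfold tangentCoord
  rw [Trivialization.symmL_apply, Trivialization.apply_mk_symm _ hq]
  exact hq

theorem symmL_tangentCoord {p q : M} (hq : q ∈ (chartAt (EuclideanSpace ℝ (Fin n)) p).source)
    (X : TangentSpace (𝓡 n) q) :
    (trivializationAt (EuclideanSpace ℝ (Fin n)) (TangentSpace (𝓡 n)) p).symmL ℝ q
      (tangentCoord p ⟨q, X⟩) = X := by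
  unfold tangentCoord
  rw [Trivialization.symmL_apply]
  · exact Trivialization.symm_apply_apply_mk _ hq X
  · exact hq

theorem tangentCoord_self (q : M) (X : TangentSpace (𝓡 n) q) :
    tangentCoord q ⟨q, X⟩ = X :=
  tangentCoordChange_self (I := 𝓡 n) (mem_extChartAt_source q)

theorem tangentCoord_eq_coordChange (p q : M) (X : TangentSpace (𝓡 n) q) :
    tangentCoord p ⟨q, X⟩ = tangentCoordChange (𝓡 n) q p q X := rfl

theorem tangentCoord_change {p q : M} {V : TangentBundle (𝓡 n) M}
    (hp : V.proj ∈ (chartAt (EuclideanSpace ℝ (Fin n)) p).source)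
    (hq : V.proj ∈ (chartAt (EuclideanSpace ℝ (Fin n)) q).source) :
    tangentCoord q V = tangentCoordChange (𝓡 n) p q V.proj (tangentCoord p V) := by
  refine (tangentCoordChange_comp (I := 𝓡 n) (v := V.2) ?_).symm
  simp [hp, hq]

theorem tangentCoord_ofCoord {p : M} {y : EuclideanSpace ℝ (Fin n)}
    (hy : y ∈ (extChartAt (𝓡 n) p).target) (u : EuclideanSpace ℝ (Fin n)) :
    tangentCoord p (ofCoord p y u) = u :=
  tangentCoord_symmL (extChartAt_symm_mem hy) u

theorem ofCoord_tangentCoord {p : M} {V : TangentBundle (𝓡 n) M}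
    (hp : V.proj ∈ (chartAt (EuclideanSpace ℝ (Fin n)) p).source) :
    ofCoord p (extChartAt (𝓡 n) p V.proj) (tangentCoord p V) = V := by
  obtain ⟨q, X⟩ := V
  have h : (extChartAt (𝓡 n) p).symm (extChartAt (𝓡 n) p q) = q :=
    (extChartAt (𝓡 n) p).left_inv (by simpa using hp)
  unfold ofCoord
  rw [h, symmL_tangentCoord hp]

variable [RiemannianBundle (fun x : M => TangentSpace (𝓡 n) x)]

theorem chartMetric_apply (p : M) (y a b : EuclideanSpace ℝ (Fin n)) :
    chartMetric n p y a b = inner ℝ (ofCoord p y a).2 (ofCoord p y b).2 := rfl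

theorem inner_eq_chartMetric {p q : M}
    (hq : q ∈ (chartAt (EuclideanSpace ℝ (Fin n)) p).source) (X Y : TangentSpace (𝓡 n) q) :
    inner ℝ X Y = chartMetric n p (extChartAt (𝓡 n) p q) (tangentCoord p ⟨q, X⟩)
      (tangentCoord p ⟨q, Y⟩) := by
  unfold chartMetric
  have h : (extChartAt (𝓡 n) p).symm (extChartAt (𝓡 n) p q) = q :=
    (extChartAt (𝓡 n) p).left_inv (by simpa using hq)
  rw [h]
  simp [symmL_tangentCoord hq]

theorem chartMetric_symm (p : M) (y a b : EuclideanSpace ℝ (Fin n)) :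
    chartMetric n p y a b = chartMetric n p y b a := by
  exact real_inner_comm (F := TangentSpace (𝓡 n) ((extChartAt (𝓡 n) p).symm y)) _ _

theorem chartMetric_self (p : M) (y a : EuclideanSpace ℝ (Fin n)) :
    chartMetric n p y a a = ‖(ofCoord p y a).2‖ ^ 2 := by
  exact real_inner_self_eq_norm_sq (F := TangentSpace (𝓡 n) ((extChartAt (𝓡 n) p).symm y)) _

theorem chartMetric_pos {p : M} {y a : EuclideanSpace ℝ (Fin n)}
    (hy : y ∈ (extChartAt (𝓡 n) p).target) (ha : a ≠ 0) : 0 < chartMetric n p y a a := by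
  rw [chartMetric_apply]
  refine real_inner_self_pos.2 fun h => ha ?_
  rw [← tangentCoord_ofCoord hy a, ← tangentCoord_ofCoord hy 0]
  simp only [ofCoord] at h ⊢
  rw [h, map_zero]
  rfl

theorem norm_sq_eq_chartMetric {p : M} {V : TangentBundle (𝓡 n) M}
    (hp : V.proj ∈ (chartAt (EuclideanSpace ℝ (Fin n)) p).source) :
    ‖V.2‖ ^ 2 = chartMetric n p (extChartAt (𝓡 n) p V.proj) (tangentCoord p V)
      (tangentCoord p V) := by
  rw [← real_inner_self_eq_norm_sq]
  exact inner_eq_chartMetric hp V.2 V.2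

/-- The coefficients are inner products of the coordinate frame fields, which are smooth sections;
in finite dimension, smoothness of all coefficients is smoothness of the bilinear form. -/
theorem contDiffOn_chartMetric [IsContMDiffRiemannianBundle (𝓡 n) ∞ (EuclideanSpace ℝ (Fin n))
      (fun x : M => TangentSpace (𝓡 n) x)] (p : M) :
    ContDiffOn ℝ ∞ (chartMetric n p) (extChartAt (𝓡 n) p).target := by
  set e := trivializationAt (EuclideanSpace ℝ (Fin n)) (TangentSpace (𝓡 n) : M → Type _) p
  have hsec : ∀ a : EuclideanSpace ℝ (Fin n), ContMDiffOn (𝓡 n) (𝓡 n).tangent ∞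
      (fun q : M => (⟨q, e.symmL ℝ q a⟩ : TangentBundle (𝓡 n) M)) e.baseSet := by
    intro a
    refine (e.contMDiffOn_section_baseSet_iff (IB := 𝓡 n)).2 ?_
    exact (contMDiffOn_const (c := a)).congr fun q hq => tangentCoord_symmL hq a
  have hcoef : ∀ a b : EuclideanSpace ℝ (Fin n),
      ContDiffOn ℝ ∞ (fun y => chartMetric n p y a b) (extChartAt (𝓡 n) p).target := by
    intro a b
    rw [← contMDiffOn_iff_contDiffOn]
    have h := ContMDiffOn.inner_bundle (IB := 𝓡 n) (F := EuclideanSpace ℝ (Fin n)) (hsec a) (hsec b)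
    exact h.comp (contMDiffOn_extChartAt_symm p) fun y hy => extChartAt_symm_mem hy
  refine contDiffOn_clm_apply.2 fun a => contDiffOn_clm_apply.2 fun b => hcoef a b

/-- The transition map between two preferred charts is an isometry. -/
theorem chartMetric_change {p q x : M}
    (hp : x ∈ (chartAt (EuclideanSpace ℝ (Fin n)) p).source)
    (hq : x ∈ (chartAt (EuclideanSpace ℝ (Fin n)) q).source) (a b : EuclideanSpace ℝ (Fin n)) :
    chartMetric n p (extChartAt (𝓡 n) p x) a b = chartMetric n q (extChartAt (𝓡 n) q x)
      (tangentCoordChange (𝓡 n) p q x a) (tangentCoordChange (𝓡 n) p q x b) := by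
  set e := trivializationAt (EuclideanSpace ℝ (Fin n)) (TangentSpace (𝓡 n) : M → Type _) p
  have h := fun c => tangentCoord_change (V := ⟨x, e.symmL ℝ x c⟩) hp hq
  simp only [e, tangentCoord_symmL hp] at h
  rw [← h, ← h, ← inner_eq_chartMetric hq, inner_eq_chartMetric hp, tangentCoord_symmL hp,
    tangentCoord_symmL hp]

end ChartMetric

/-! ### Christoffel symbols of the first kind and their transformation law -/

section Koszul

variable {E : Type*} [NormedAddCommGroup E] [NormedSpace ℝ E]

instance normedAddCommGroupBilin : NormedAddCommGroup (E →L[ℝ] E →L[ℝ] ℝ) :=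
  ContinuousLinearMap.toNormedAddCommGroup

instance normedSpaceBilin : NormedSpace ℝ (E →L[ℝ] E →L[ℝ] ℝ) :=
  ContinuousLinearMap.toNormedSpace

instance normedAddCommGroupTrilin : NormedAddCommGroup (E →L[ℝ] E →L[ℝ] E →L[ℝ] ℝ) :=
  ContinuousLinearMap.toNormedAddCommGroup

instance normedSpaceTrilin : NormedSpace ℝ (E →L[ℝ] E →L[ℝ] E →L[ℝ] ℝ) :=
  ContinuousLinearMap.toNormedSpace

/-- The Christoffel symbols of the first kind built from the derivative `D` of a metric. -/
def koszul (D : E →L[ℝ] E →L[ℝ] E →L[ℝ] ℝ) (u v : E) : E →L[ℝ] ℝ :=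
  (1 / 2 : ℝ) • ((D u).flip v + D v u - (D.flip u).flip v)

theorem koszul_apply (D : E →L[ℝ] E →L[ℝ] E →L[ℝ] ℝ) (u v w : E) :
    koszul D u v w = (D u w v + D v u w - D w u v) / 2 := by
  simp only [koszul, smul_apply, sub_apply,
    add_apply, ContinuousLinearMap.flip_apply, smul_eq_mul]
  ring

/-- Transformation law of the Christoffel symbols of the first kind. -/
theorem koszul_change {G H : E → E →L[ℝ] E →L[ℝ] ℝ} {τ : E → E} {T : E → E →L[ℝ] E}
    {T' : E →L[ℝ] E →L[ℝ] E} {D D' : E →L[ℝ] E →L[ℝ] E →L[ℝ] ℝ} {y : E}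
    (hG : HasFDerivAt G D y) (hH : HasFDerivAt H D' (τ y)) (hτ : HasFDerivAt τ (T y) y)
    (hT : HasFDerivAt T T' y) (hsymmT : ∀ a b, T' a b = T' b a)
    (hsymm : ∀ x a b, H x a b = H x b a)
    (hGH : ∀ᶠ x in 𝓝 y, ∀ a b, G x a b = H (τ x) (T x a) (T x b)) (a b w : E) :
    koszul D a b w = koszul D' (T y a) (T y b) (T y w) + H (τ y) (T' a b) (T y w) := by
  -- Product rule for G = τ*H. In the Koszul combination the terms with T' cancel in pairs, by the
  -- symmetry of T', except for two copies of H (T' a b) (T w).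
  have key : ∀ c a b, D c a b = D' (T y c) (T y a) (T y b) + H (τ y) (T' c a) (T y b)
      + H (τ y) (T y a) (T' c b) := by
    intro c a b
    have h1 : HasFDerivAt (fun x => G x a b) ((D.flip a).flip b) y := by
      have := (hG.clm_apply (hasFDerivAt_const a y)).clm_apply (hasFDerivAt_const b y)
      convert! this using 1
      ext; simp
    have hHτ : HasFDerivAt (fun x => H (τ x)) (D'.comp (T y)) y :=
      HasFDerivAt.comp (G := E →L[ℝ] E →L[ℝ] ℝ) y hH hτ
    have h2 := (hHτ.clm_apply (hT.clm_apply (hasFDerivAt_const a y))).clm_apply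
      (hT.clm_apply (hasFDerivAt_const b y))
    have := h1.unique (h2.congr_of_eventuallyEq (hGH.mono fun x hx => hx a b))
    have := congr($this c)
    simp at this
    rw [this]
    ring
  simp only [koszul_apply, key, hsymmT b a, hsymmT w a, hsymmT w b]
  rw [hsymm _ (T y w) (T' a b)]
  ring

theorem hasDerivAt_clm_comp_apply {F : Type*} [NormedAddCommGroup F] [NormedSpace ℝ F]
    {T : E → E →L[ℝ] F} {T' : E →L[ℝ] E →L[ℝ] F} {y u : ℝ → E} {y' u' : E} {t : ℝ}
    (hT : HasFDerivAt T T' (y t)) (hy : HasDerivAt y y' t) (hu : HasDerivAt u u' t) :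
    HasDerivAt (fun s => T (y s) (u s)) (T' y' (u t) + T (y t) u') t := by
  have h : HasDerivAt (fun s => T (y s)) (T' y') t :=
    HasFDerivAt.comp_hasDerivAt (E := E →L[ℝ] F) t hT hy
  exact h.clm_apply hu

end Koszul

/-! ### The connection map in an arbitrary chart -/

section Coordinates

variable {n : ℕ} {M : Type*} [TopologicalSpace M] [ChartedSpace (EuclideanSpace ℝ (Fin n)) M]
  [IsManifold (𝓡 n) ∞ M]

theorem hasDerivAt_extChartAt_comp {γ : ℝ → M} {t : ℝ} {p : M}
    (hγ : MDifferentiableAt 𝓘(ℝ, ℝ) (𝓡 n) γ t)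
    (hp : γ t ∈ (chartAt (EuclideanSpace ℝ (Fin n)) p).source) :
    HasDerivAt (F := EuclideanSpace ℝ (Fin n)) (fun s => extChartAt (𝓡 n) p (γ s))
      (tangentCoord p (velocity n γ t)) t := by
  have h := (mdifferentiableAt_extChartAt (I := 𝓡 n) hp).hasMFDerivAt.comp t hγ.hasMFDerivAt
  let L : ℝ →L[ℝ] EuclideanSpace ℝ (Fin n) := (mfderiv (𝓡 n) 𝓘(ℝ, EuclideanSpace ℝ (Fin n))
    (extChartAt (𝓡 n) p) (γ t)).comp (mfderiv 𝓘(ℝ, ℝ) (𝓡 n) γ t)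
  have h1 : HasFDerivAt (extChartAt (𝓡 n) p ∘ γ) L t := hasMFDerivAt_iff_hasFDerivAt.1 h
  have h' := h1.hasDerivAt
  convert! h' using 1
  have := mfderiv_chartAt_eq_tangentCoordChange (I := 𝓡 n) (y := p) (x := γ t) (by simpa using hp)
  exact (congr($this (mfderiv 𝓘(ℝ, ℝ) (𝓡 n) γ t (1 : ℝ)))).symm

/-- The preferred chart of TM at V t is the bundle chart over the preferred chart of M at the foot
point, so in these coordinates `mfderiv` is the ordinary derivative by definition. -/
theorem hasDerivAt_tangentCoord_self {V : ℝ → TangentBundle (𝓡 n) M} {t : ℝ}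
    (hV : MDifferentiableAt 𝓘(ℝ, ℝ) (𝓡 n).tangent V t) :
    HasDerivAt (fun s => (extChartAt (𝓡 n) (V t).proj (V s).proj, tangentCoord (V t).proj (V s)))
      (show EuclideanSpace ℝ (Fin n) × EuclideanSpace ℝ (Fin n) from
        mfderiv 𝓘(ℝ, ℝ) (𝓡 n).tangent V t (1 : ℝ)) t := by
  have h := hV.hasMFDerivAt.2
  let L : ℝ →L[ℝ] EuclideanSpace ℝ (Fin n) × EuclideanSpace ℝ (Fin n) :=
    mfderiv 𝓘(ℝ, ℝ) (𝓡 n).tangent V t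
  have h' : HasFDerivWithinAt
      (fun s => (extChartAt (𝓡 n) (V t).proj (V s).proj, tangentCoord (V t).proj (V s)))
      L univ t := by
    rw [← show range 𝓘(ℝ, ℝ) = univ by simp]
    exact h
  exact (hasFDerivWithinAt_univ.1 h').hasDerivAt

theorem mdifferentiableAt_proj {V : ℝ → TangentBundle (𝓡 n) M} {t : ℝ}
    (hV : MDifferentiableAt 𝓘(ℝ, ℝ) (𝓡 n).tangent V t) :
    MDifferentiableAt 𝓘(ℝ, ℝ) (𝓡 n) (fun s => (V s).proj) t :=
  ((mdifferentiableAt_totalSpace (𝓡 n) V).1 hV).1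

theorem dproj_mfderiv {V : ℝ → TangentBundle (𝓡 n) M} {t : ℝ}
    (hV : MDifferentiableAt 𝓘(ℝ, ℝ) (𝓡 n).tangent V t) :
    dproj (V t) (mfderiv 𝓘(ℝ, ℝ) (𝓡 n).tangent V t (1 : ℝ)) =
      mfderiv 𝓘(ℝ, ℝ) (𝓡 n) (fun s => (V s).proj) t (1 : ℝ) := by
  have hπ : MDifferentiableAt (𝓡 n).tangent (𝓡 n) (fun w : TangentBundle (𝓡 n) M => w.proj) (V t) :=
    (contMDiff_proj (IB := 𝓡 n) (n := 1) (TangentSpace (𝓡 n) : M → Type _)).mdifferentiable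
      one_ne_zero _
  have := mfderiv_comp (I' := (𝓡 n).tangent) t hπ hV
  exact (congr($this (1 : ℝ))).symm

theorem tangentCoordChange_eq_fderiv (p q x : M) : tangentCoordChange (𝓡 n) p q x =
    fderiv ℝ (extChartAt (𝓡 n) q ∘ (extChartAt (𝓡 n) p).symm) (extChartAt (𝓡 n) p x) := by
  rw [tangentCoordChange_def]
  simp

theorem contDiffAt_chartChange {p q x : M}
    (hp : x ∈ (chartAt (EuclideanSpace ℝ (Fin n)) p).source)
    (hq : x ∈ (chartAt (EuclideanSpace ℝ (Fin n)) q).source) :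
    ContDiffAt ℝ ∞ (extChartAt (𝓡 n) q ∘ (extChartAt (𝓡 n) p).symm) (extChartAt (𝓡 n) p x) := by
  have h := contDiffWithinAt_ext_coord_change (I := 𝓡 n) (n := ∞) q p
    (y := extChartAt (𝓡 n) p x) (by
      rw [PartialEquiv.trans_source, PartialEquiv.symm_source]
      refine ⟨(extChartAt (𝓡 n) p).map_source (by simpa using hp), ?_⟩
      rw [mem_preimage, (extChartAt (𝓡 n) p).left_inv (by simpa using hp)]
      simpa using hq)
  simpa [contDiffWithinAt_univ] using h

variable [RiemannianBundle (fun x : M => TangentSpace (𝓡 n) x)]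

theorem inner_christoffel (p : M) (u v w : TangentSpace (𝓡 n) p) :
    inner ℝ (christoffel p u v) w = koszul (fderiv ℝ (chartMetric n p) (extChartAt (𝓡 n) p p))
      u v w := by
  have : FiniteDimensional ℝ (TangentSpace (𝓡 n) p) :=
    inferInstanceAs (FiniteDimensional ℝ (EuclideanSpace ℝ (Fin n)))
  have : CompleteSpace (TangentSpace (𝓡 n) p) := FiniteDimensional.complete ℝ _
  unfold christoffel
  exact InnerProductSpace.toDual_symm_apply

variable [IsContMDiffRiemannianBundle (𝓡 n) ∞ (EuclideanSpace ℝ (Fin n))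
      (fun x : M => TangentSpace (𝓡 n) x)]

theorem hasFDerivAt_chartMetric {p : M} {y : EuclideanSpace ℝ (Fin n)}
    (hy : y ∈ (extChartAt (𝓡 n) p).target) :
    HasFDerivAt (chartMetric n p) (fderiv ℝ (chartMetric n p) y) y :=
  (((contDiffOn_chartMetric p).contDiffAt
    ((isOpen_extChartAt_target p).mem_nhds hy)).differentiableAt (by simp)).hasFDerivAt

set_option maxHeartbeats 1000000 in
/-- The connection map in the preferred chart around an arbitrary point. -/
theorem connectionMap_coord {V : ℝ → TangentBundle (𝓡 n) M} {t : ℝ} {p : M}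
    (hV : MDifferentiableAt 𝓘(ℝ, ℝ) (𝓡 n).tangent V t)
    (hp : (V t).proj ∈ (chartAt (EuclideanSpace ℝ (Fin n)) p).source) :
    ∃ y' u' : EuclideanSpace ℝ (Fin n),
      HasDerivAt (fun s => extChartAt (𝓡 n) p (V s).proj) y' t ∧
      HasDerivAt (fun s => tangentCoord p (V s)) u' t ∧
      tangentCoord p ⟨(V t).proj, dproj (V t)
        (mfderiv 𝓘(ℝ, ℝ) (𝓡 n).tangent V t (1 : ℝ))⟩ = y' ∧
      ∀ w, chartMetric n p (extChartAt (𝓡 n) p (V t).proj) (tangentCoord p ⟨(V t).proj,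
          connectionMap (V t) (mfderiv 𝓘(ℝ, ℝ) (𝓡 n).tangent V t (1 : ℝ))⟩) w =
        chartMetric n p (extChartAt (𝓡 n) p (V t).proj) u' w +
        koszul (fderiv ℝ (chartMetric n p) (extChartAt (𝓡 n) p (V t).proj)) y'
          (tangentCoord p (V t)) w := by
  set q := (V t).proj with hq
  have hqq := mem_chart_source (EuclideanSpace ℝ (Fin n)) q
  have h := hasDerivAt_tangentCoord_self hV
  set ξ : EuclideanSpace ℝ (Fin n) × EuclideanSpace ℝ (Fin n) :=
    mfderiv 𝓘(ℝ, ℝ) (𝓡 n).tangent V t (1 : ℝ) with hξ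
  have h1 : HasDerivAt (fun s => extChartAt (𝓡 n) q (V s).proj) ξ.1 t :=
    (ContinuousLinearMap.fst ℝ (EuclideanSpace ℝ (Fin n))
      (EuclideanSpace ℝ (Fin n))).hasFDerivAt.comp_hasDerivAt t h
  have h2 : HasDerivAt (fun s => tangentCoord q (V s)) ξ.2 t :=
    (ContinuousLinearMap.snd ℝ (EuclideanSpace ℝ (Fin n))
      (EuclideanSpace ℝ (Fin n))).hasFDerivAt.comp_hasDerivAt t h
  -- `connectionMap` is defined in the preferred chart at the foot point q; τ carries it to the
  -- chart at p.
  set τ := extChartAt (𝓡 n) p ∘ (extChartAt (𝓡 n) q).symm with hτ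
  have hcd : ContDiffAt ℝ ∞ τ (extChartAt (𝓡 n) q q) := contDiffAt_chartChange hqq hp
  have hτ1 : HasFDerivAt τ (fderiv ℝ τ (extChartAt (𝓡 n) q q)) (extChartAt (𝓡 n) q q) :=
    (hcd.differentiableAt (by simp)).hasFDerivAt
  have hτ2 : HasFDerivAt (fderiv ℝ τ) (fderiv ℝ (fderiv ℝ τ) (extChartAt (𝓡 n) q q))
      (extChartAt (𝓡 n) q q) :=
    ((hcd.fderiv_right (m := 1) (by norm_cast)).differentiableAt (by simp)).hasFDerivAt
  have hcont : ContinuousAt (fun s => (V s).proj) t := (mdifferentiableAt_proj hV).continuousAt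
  have hevp : ∀ᶠ s in 𝓝 t, (V s).proj ∈ (chartAt (EuclideanSpace ℝ (Fin n)) p).source :=
    hcont ((chartAt _ p).open_source.mem_nhds hp)
  have hevq : ∀ᶠ s in 𝓝 t, (V s).proj ∈ (chartAt (EuclideanSpace ℝ (Fin n)) q).source :=
    hcont ((chartAt _ q).open_source.mem_nhds hqq)
  have hleft : ∀ {x : M}, x ∈ (chartAt (EuclideanSpace ℝ (Fin n)) q).source →
      (extChartAt (𝓡 n) q).symm (extChartAt (𝓡 n) q x) = x :=
    fun hx => (extChartAt (𝓡 n) q).left_inv (by simpa using hx)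
  have hτq : τ (extChartAt (𝓡 n) q q) = extChartAt (𝓡 n) p q := by
    simp only [hτ, Function.comp_apply, hleft hqq]
  have hchange : ∀ X : TangentSpace (𝓡 n) q, tangentCoord p ⟨q, X⟩ =
      fderiv ℝ τ (extChartAt (𝓡 n) q q) X := fun X => by
    rw [tangentCoord_eq_coordChange, tangentCoordChange_eq_fderiv]
  have hy : HasDerivAt (fun s => extChartAt (𝓡 n) p (V s).proj)
      (fderiv ℝ τ (extChartAt (𝓡 n) q q) ξ.1) t := by
    refine (hτ1.comp_hasDerivAt t h1).congr_of_eventuallyEq ?_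
    filter_upwards [hevq] with s hs
    simp only [hτ, Function.comp_apply, hleft hs]
  -- The second derivative of τ that appears here is the inhomogeneous term of the transformation
  -- law `koszul_change`, which is why the formula keeps its form in the new chart.
  have hu : HasDerivAt (fun s => tangentCoord p (V s))
      (fderiv ℝ (fderiv ℝ τ) (extChartAt (𝓡 n) q q) ξ.1 (tangentCoord q (V t)) +
        fderiv ℝ τ (extChartAt (𝓡 n) q q) ξ.2) t := by
    refine (hasDerivAt_clm_comp_apply hτ2 h1 h2).congr_of_eventuallyEq ?_
    filter_upwards [hevq, hevp] with s hs hs'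
    rw [tangentCoord_change hs hs', tangentCoordChange_eq_fderiv]
  have hdproj : dproj (V t) (mfderiv 𝓘(ℝ, ℝ) (𝓡 n).tangent V t (1 : ℝ)) = ξ.1 := by
    rw [dproj_mfderiv hV]
    have := (hasDerivAt_extChartAt_comp (mdifferentiableAt_proj hV) hqq).unique h1
    rwa [velocity, tangentCoord_self] at this
  refine ⟨_, _, hy, hu, (hchange _).trans (congrArg _ hdproj), fun w => ?_⟩
  obtain ⟨w, rfl⟩ : ∃ w' : TangentSpace (𝓡 n) q, tangentCoord p ⟨q, w'⟩ = w :=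
    ⟨_, tangentCoord_symmL hp w⟩
  have hkos := koszul_change (G := chartMetric n q) (H := chartMetric n p) (τ := τ)
    (T := fderiv ℝ τ) (y := extChartAt (𝓡 n) q q)
    (hasFDerivAt_chartMetric (mem_extChartAt_target q))
    (hasFDerivAt_chartMetric (p := p) (by
      rw [hτq]
      exact (extChartAt (𝓡 n) p).map_source (by simpa using hp))) hτ1 hτ2
    (fun a b => (hcd.isSymmSndFDerivAt (by simp; norm_cast)).eq a b) (chartMetric_symm p)
    (by
      have := extChartAt_target_mem_nhds (I := 𝓡 n) q
      have hc : ContinuousAt (extChartAt (𝓡 n) q).symm (extChartAt (𝓡 n) q q) :=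
        continuousAt_extChartAt_symm q
      have h3 := hc ((chartAt _ p).open_source.mem_nhds (by rwa [hleft hqq]))
      filter_upwards [this, h3] with x hx hx' a b
      have := chartMetric_change (extChartAt_symm_mem hx) hx' a b
      rwa [tangentCoordChange_eq_fderiv, (extChartAt (𝓡 n) q).right_inv hx] at this)
    ξ.1 (tangentCoord q (V t)) w
  rw [← inner_eq_chartMetric hp]
  let η₁ : TangentSpace (𝓡 n) q := ξ.1
  let η₂ : TangentSpace (𝓡 n) q := ξ.2
  have hconn : connectionMap (V t) (mfderiv 𝓘(ℝ, ℝ) (𝓡 n).tangent V t (1 : ℝ)) =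
      η₂ + christoffel q η₁ (V t).2 := rfl
  have hself : tangentCoord q (V t) = (V t).2 := tangentCoord_self _ _
  have e₁ := inner_eq_chartMetric hp η₂ w
  have e₂ := inner_christoffel q η₁ (V t).2 w
  rw [hconn, inner_add_left, e₁, e₂, hchange, hchange]
  have e₃ : tangentCoord p (V t) = fderiv ℝ τ (extChartAt (𝓡 n) q q) (tangentCoord q (V t)) := by
    rw [tangentCoord_change (p := q) (q := p) hqq hp, tangentCoordChange_eq_fderiv]
  rw [e₃]
  rw [hτq] at hkos
  rw [map_add, add_apply]
  rw [← hself]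
  refine (congrArg _ hkos).trans ?_
  simp only [η₂]
  ring

end Coordinates

/-! ### The geodesic spray of a metric on an open set -/

section Spray

variable {E : Type*} [NormedAddCommGroup E] [NormedSpace ℝ E]

/-- A smooth Riemannian metric on an open subset of a vector space. -/
structure IsMetricOn (G : E → E →L[ℝ] E →L[ℝ] ℝ) (U : Set E) : Prop where
  isOpen : IsOpen U
  contDiffOn : ContDiffOn ℝ ∞ G U
  symm : ∀ x a b, G x a b = G x b a
  pos : ∀ x ∈ U, ∀ a, a ≠ 0 → 0 < G x a a

variable {G : E → E →L[ℝ] E →L[ℝ] ℝ} {U : Set E} {x : E}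

theorem IsMetricOn.contDiffAt (hG : IsMetricOn G U) (hx : x ∈ U) : ContDiffAt ℝ ∞ G x :=
  hG.contDiffOn.contDiffAt (hG.isOpen.mem_nhds hx)

theorem IsMetricOn.hasFDerivAt (hG : IsMetricOn G U) (hx : x ∈ U) :
    HasFDerivAt G (fderiv ℝ G x) x :=
  ((hG.contDiffAt hx).differentiableAt (by simp)).hasFDerivAt

theorem IsMetricOn.contDiffAt_fderiv (hG : IsMetricOn G U) (hx : x ∈ U) :
    ContDiffAt ℝ ∞ (fderiv ℝ G) x :=
  (hG.contDiffAt hx).fderiv_right (by norm_cast)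

theorem IsMetricOn.nonneg (hG : IsMetricOn G U) (hx : x ∈ U) (a : E) : 0 ≤ G x a a := by
  rcases eq_or_ne a 0 with rfl | ha
  · simp
  · exact (hG.pos x hx a ha).le

theorem IsMetricOn.cauchySchwarz (hG : IsMetricOn G U) (hx : x ∈ U) (a b : E) :
    (G x a b) ^ 2 ≤ G x a a * G x b b := by
  have h : ∀ t : ℝ, 0 ≤ G x a a + 2 * t * G x a b + t ^ 2 * G x b b := fun t => by
    have := hG.nonneg hx (a + t • b)
    simp only [map_add, map_smul, add_apply, smul_apply, smul_eq_mul] at this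
    rw [hG.symm x b a] at this
    linarith
  rcases eq_or_ne b 0 with rfl | hb
  · simp
  have hbb := hG.pos x hx b hb
  -- The minimiser of the quadratic polynomial t ↦ G x (a + t b) (a + t b).
  have := h (-(G x a b) / G x b b)
  have h2 : G x a a + 2 * (-(G x a b) / G x b b) * G x a b +
      (-(G x a b) / G x b b) ^ 2 * G x b b = (G x a a * G x b b - (G x a b) ^ 2) / G x b b := by
    field_simp
    ring
  rw [h2] at this
  have := (div_nonneg_iff.1 this)
  rcases this with h | h
  · linarith [h.1]
  · linarith [h.2]

theorem IsMetricOn.fderiv_symm (hG : IsMetricOn G U) (hx : x ∈ U) (c a b : E) :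
    fderiv ℝ G x c a b = fderiv ℝ G x c b a := by
  have h : ∀ a b, HasFDerivAt (fun y => G y a b) (((fderiv ℝ G x).flip a).flip b) x := by
    intro a b
    have := ((hG.hasFDerivAt hx).clm_apply (hasFDerivAt_const a x)).clm_apply
      (hasFDerivAt_const b x)
    convert! this using 1
    ext; simp
  have h1 := h a b
  simp only [hG.symm _ a b] at h1
  simpa using congr($(h1.unique (h b a)) c)

theorem koszul_self_apply (hG : IsMetricOn G U) (hx : x ∈ U) (u w : E) :
    koszul (fderiv ℝ G x) u u w = fderiv ℝ G x u u w - fderiv ℝ G x w u u / 2 := by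
  rw [koszul_apply, hG.fderiv_symm hx u w u]
  ring

variable [FiniteDimensional ℝ E]

/-- Positive definiteness gives injectivity into the dual, which has the same dimension. -/
theorem IsMetricOn.isInvertible (hG : IsMetricOn G U) (hx : x ∈ U) : (G x).IsInvertible := by
  have hinj : Function.Injective (G x) := by
    rw [injective_iff_map_eq_zero]
    intro a ha
    by_contra h
    have := hG.pos x hx a h
    simp [ha] at this
  have hdim : Module.finrank ℝ E = Module.finrank ℝ (E →L[ℝ] ℝ) := by
    rw [← (LinearMap.toContinuousLinearMap (𝕜 := ℝ) (E := E) (F' := ℝ)).finrank_eq]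
    exact (Subspace.dual_finrank_eq (K := ℝ) (V := E)).symm
  let e : E ≃ₗ[ℝ] (E →L[ℝ] ℝ) := LinearEquiv.ofInjectiveOfFinrankEq (G x).toLinearMap hinj hdim
  exact ⟨e.toContinuousLinearEquiv, by ext; rfl⟩

/-- The acceleration of geodesics as a function of position and velocity. -/
def geodesicAccel (G : E → E →L[ℝ] E →L[ℝ] ℝ) (z : E × E) : E :=
  -(G z.1).inverse (koszul (fderiv ℝ G z.1) z.2 z.2)

/-- Pairing with the metric removes the inverse, so that later computations only meet `koszul`. -/
theorem metric_geodesicAccel (hG : IsMetricOn G U) (hx : x ∈ U) (u w : E) :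
    G x (geodesicAccel G (x, u)) w = -koszul (fderiv ℝ G x) u u w := by
  obtain ⟨e, he⟩ := hG.isInvertible hx
  simp only [geodesicAccel]
  rw [map_neg, ← he, ContinuousLinearMap.inverse_equiv]
  simp

theorem eq_geodesicAccel (hG : IsMetricOn G U) (hx : x ∈ U) {u a : E}
    (h : ∀ w, G x a w = -koszul (fderiv ℝ G x) u u w) : a = geodesicAccel G (x, u) := by
  by_contra hne
  have := hG.pos x hx _ (sub_ne_zero.2 hne)
  rw [map_sub (G x), sub_apply, h, metric_geodesicAccel hG hx] at this
  simp at this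

omit [FiniteDimensional ℝ E] in
theorem koszul_smul (D : E →L[ℝ] E →L[ℝ] E →L[ℝ] ℝ) (s : ℝ) (u : E) :
    koszul D (s • u) (s • u) = s ^ 2 • koszul D u u := by
  ext w
  simp only [koszul_apply, map_smul, smul_apply, smul_eq_mul]
  ring

omit [FiniteDimensional ℝ E] in
-- Quadratic homogeneity serves twice: it gives the linearisation of the spray at zero velocity, and
-- it lets a geodesic be reparametrised at another constant speed.
theorem geodesicAccel_smul (s : ℝ) (u : E) :
    geodesicAccel G (x, s • u) = s ^ 2 • geodesicAccel G (x, u) := by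
  simp only [geodesicAccel, koszul_smul, map_smul, smul_neg]

/-- The geodesic spray. -/
def spray (G : E → E →L[ℝ] E →L[ℝ] ℝ) (z : E × E) : E × E := (z.2, geodesicAccel G z)

theorem contDiffAt_spray (hG : IsMetricOn G U) (hx : x ∈ U) (u : E) :
    ContDiffAt ℝ 1 (spray G) (x, u) := by
  have hG1 : ContDiffAt ℝ 1 (fun z : E × E => G z.1) (x, u) :=
    ((hG.contDiffAt hx).of_le (by simp)).comp (x, u) contDiffAt_fst
  have hk : ContDiffOn ℝ 1 (fun z : E × E => koszul (fderiv ℝ G z.1) z.2 z.2) (U ×ˢ univ) := by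
    refine contDiffOn_clm_apply.2 fun w z hz => ContDiffAt.contDiffWithinAt ?_
    have hD : ContDiffAt ℝ 1 (fun z : E × E => fderiv ℝ G z.1) z :=
      ((hG.contDiffAt_fderiv hz.1).of_le (by simp)).comp z contDiffAt_fst
    have hu : ContDiffAt ℝ 1 (fun z : E × E => z.2) z := contDiffAt_snd
    have hw : ContDiffAt ℝ 1 (fun _ : E × E => w) z := contDiffAt_const
    simp only [koszul_apply]
    exact ((((hD.clm_apply hu).clm_apply hw).clm_apply hu).add
      (((hD.clm_apply hu).clm_apply hu).clm_apply hw)).sub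
      (((hD.clm_apply hw).clm_apply hu).clm_apply hu) |>.div_const 2
  have hk' := hk.contDiffAt ((hG.isOpen.prod isOpen_univ).mem_nhds (x := (x, u)) ⟨hx, trivial⟩)
  obtain ⟨e, he⟩ := hG.isInvertible hx
  have hinv : ContDiffAt ℝ 1 (fun z : E × E => (G z.1).inverse) (x, u) := by
    have h1 : ContDiffAt ℝ 1 ContinuousLinearMap.inverse ((fun z : E × E => G z.1) (x, u)) := by
      simp only [← he]
      exact contDiffAt_map_inverse e
    exact h1.comp (x, u) hG1
  exact contDiffAt_snd.prodMk (hinv.clm_apply hk').neg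

/-- The acceleration is quadratic in the velocity, so it does not contribute to first order at rest:
the linearisation is that of free motion, (a, b) ↦ (b, 0). -/
theorem hasFDerivAt_spray_zero (hG : IsMetricOn G U) (hx : x ∈ U) :
    HasFDerivAt (spray G) ((ContinuousLinearMap.inl ℝ E E).comp (ContinuousLinearMap.snd ℝ E E))
      (x, 0) := by
  have h := ((contDiffAt_spray hG hx 0).differentiableAt (by simp)).hasFDerivAt
  convert! h using 1
  have h1 : HasFDerivAt (fun a : E => spray G (a, 0)) (0 : E →L[ℝ] E × E) x := by
    have : (fun a : E => spray G (a, 0)) = fun _ => 0 := by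
      ext1 a
      have := geodesicAccel_smul (G := G) (x := a) 0 0
      simp only [spray]
      simp_all
    rw [this]
    exact hasFDerivAt_const _ _
  have h1' := h1.unique
    (HasFDerivAt.comp (G := E × E) (g := spray G) x h (hasFDerivAt_prodMk_left x 0))
  have h2 : ∀ b, fderiv ℝ (spray G) (x, 0) (0, b) = (b, 0) := by
    intro b
    have hc : HasDerivAt (fun s : ℝ => ((x, s • b) : E × E)) (0, b) 0 := by
      have := (hasDerivAt_const (0 : ℝ) x).prodMk ((hasDerivAt_id (0 : ℝ)).smul_const b)
      simpa using this
    have h3 : HasDerivAt (fun s : ℝ => spray G (x, s • b)) (fderiv ℝ (spray G) (x, 0) (0, b)) 0 :=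
      HasFDerivAt.comp_hasDerivAt (E := E × E) (l := spray G) 0 (by simpa using h) hc
    have h4 : HasDerivAt (fun s : ℝ => spray G (x, s • b)) (b, 0) 0 := by
      simp only [spray, geodesicAccel_smul]
      have h5 := ((hasDerivAt_id (0 : ℝ)).smul_const b).prodMk
        (((hasDerivAt_id (0 : ℝ)).pow 2).smul_const (geodesicAccel G (x, b)))
      simpa using h5
    exact h3.unique h4
  refine ContinuousLinearMap.ext fun z => ?_
  obtain ⟨a, b⟩ := z
  have hab : ((a, b) : E × E) = (a, 0) + (0, b) := by simp
  have h6 : fderiv ℝ (spray G) (x, 0) (a, 0) = 0 := by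
    simpa using (congr($h1' a)).symm
  rw [hab, map_add (fderiv ℝ (spray G) (x, 0)), h2, h6]
  simp

/-- At x the bound is the minimum over the compact unit sphere; continuity of G preserves half of it
nearby. -/
theorem IsMetricOn.exists_lower_bound (hG : IsMetricOn G U) (hx : x ∈ U) :
    ∃ m > 0, ∀ᶠ y in 𝓝 x, ∀ h, m * ‖h‖ ^ 2 ≤ G y h h := by
  obtain ⟨m, hm, hmG⟩ : ∃ m > 0, ∀ h, m * ‖h‖ ^ 2 ≤ G x h h := by
    rcases subsingleton_or_nontrivial E with hE | hE
    · exact ⟨1, one_pos, fun h => by simp [Subsingleton.elim h 0]⟩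
    obtain ⟨v, hv, hmin⟩ := (isCompact_sphere (0 : E) 1).exists_isMinOn
      (NormedSpace.sphere_nonempty.2 zero_le_one) (f := fun h => G x h h) (by fun_prop)
    have hv0 : v ≠ 0 := by
      rintro rfl
      simp at hv
    refine ⟨G x v v, hG.pos x hx v hv0, fun h => ?_⟩
    rcases eq_or_ne h 0 with rfl | hh
    · simp
    have hh' : ‖h‖ ≠ 0 := norm_ne_zero_iff.2 hh
    have := hmin (a := ‖h‖⁻¹ • h) (by simp [norm_smul, hh'])
    simp only [mem_ofPred_eq, map_smul, smul_apply, smul_eq_mul] at this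
    calc G x v v * ‖h‖ ^ 2 ≤ (‖h‖⁻¹ * (‖h‖⁻¹ * G x h h)) * ‖h‖ ^ 2 := by gcongr
      _ = G x h h := by field_simp
  refine ⟨m / 2, half_pos hm, ?_⟩
  have hc : ContinuousAt G x := (hG.contDiffAt hx).continuousAt
  filter_upwards [Metric.continuousAt_iff'.1 hc (m / 2) (half_pos hm)] with y hy h
  rw [dist_eq_norm] at hy
  have h1 : |(G y - G x) h h| ≤ m / 2 * ‖h‖ ^ 2 := by
    calc |(G y - G x) h h| ≤ ‖G y - G x‖ * ‖h‖ * ‖h‖ := (G y - G x).le_opNorm₂ h h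
      _ ≤ m / 2 * ‖h‖ * ‖h‖ := by gcongr
      _ = _ := by ring
  have h2 := (abs_le.1 h1).1
  simp only [sub_apply] at h2
  linarith [hmG h]

end Spray

/-! ### Local flow of a second order equation near a rest point -/

section LocalFlow

variable {E : Type*} [NormedAddCommGroup E] [NormedSpace ℝ E]

/-- A second order equation near a rest point has a local flow that is Lipschitz in the initial
velocity, and whose position at a fixed small time is close to a multiple of the initial
velocity. -/
theorem exists_local_flow [CompleteSpace E] {f : E × E → E × E} {x₀ : E}
    (hf : ContDiffAt ℝ 1 f (x₀, 0)) (hf₀ : f (x₀, 0) = 0)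
    (hf' : HasFDerivAt f ((ContinuousLinearMap.inl ℝ E E).comp (ContinuousLinearMap.snd ℝ E E))
      (x₀, 0)) (hfst : ∀ z, (f z).1 = z.2) {N : Set (E × E)} (hN : N ∈ 𝓝 (x₀, 0)) :
    ∃ ε > 0, ∃ ρ > 0, ∃ L > 0, ∃ Z : E → ℝ → E × E,
      (∀ w ∈ Metric.ball (0 : E) ρ, Z w 0 = (x₀, w)) ∧ Z 0 ε = (x₀, 0) ∧
      (∀ w ∈ Metric.ball (0 : E) ρ, ∀ t ∈ Icc 0 ε, HasDerivAt (Z w) (f (Z w t)) t) ∧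
      (∀ w ∈ Metric.ball (0 : E) ρ, ∀ t ∈ Icc 0 ε, Z w t ∈ N) ∧
      (∀ w ∈ Metric.ball (0 : E) ρ, ∀ v ∈ Metric.ball (0 : E) ρ, ∀ t ∈ Icc 0 ε,
        ‖Z w t - Z v t‖ ≤ L * ‖w - v‖) ∧
      (∀ w ∈ Metric.ball (0 : E) ρ, ∀ v ∈ Metric.ball (0 : E) ρ,
        ‖(Z w ε).1 - (Z v ε).1 - ε • (w - v)‖ ≤ ε / 2 * ‖w - v‖) := by
  obtain ⟨ε₀, hε₀, a, r, L₀, K₀, hr, hpl⟩ := IsPicardLindelof.of_contDiffAt_one hf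
  obtain ⟨α, hα, L', hL'⟩ :=
    (hpl 0).exists_forall_mem_closedBall_eq_hasDerivWithinAt_lipschitzOnWith
  have hαd : ∀ z ∈ Metric.closedBall (x₀, (0 : E)) r, ∀ t ∈ Ioo (-ε₀) ε₀,
      HasDerivAt (α z) (f (α z t)) t := fun z hz t ht =>
    ((hα z hz).2 t ⟨by linarith [ht.1], by linarith [ht.2]⟩).hasDerivAt
      (Icc_mem_nhds (by linarith [ht.1]) (by linarith [ht.2]))
  have hα0 : ∀ z ∈ Metric.closedBall (x₀, (0 : E)) r, α z 0 = z := fun z hz => (hα z hz).1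
  have hz₀ : (x₀, (0 : E)) ∈ Metric.closedBall (x₀, (0 : E)) r :=
    Metric.mem_closedBall_self r.2
  obtain ⟨K, s, hs, hK⟩ := hf.exists_lipschitzOnWith
  -- The rest point is a constant solution, and solutions are unique where f is Lipschitz.
  -- Trajectories with small initial velocity can then be compared with it.
  have hconst : α (x₀, 0) =ᶠ[𝓝 0] fun _ => (x₀, 0) := by
    have h0 : Ioo (-ε₀) ε₀ ∈ 𝓝 (0 : ℝ) := Ioo_mem_nhds (by linarith) hε₀
    refine ODE_solution_unique_of_eventually (v := fun _ => f) (s := fun _ => s) (K := K)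
      (.of_forall fun _ => hK) ?_ (.of_forall fun t => ⟨?_, mem_of_mem_nhds hs⟩)
      (by rw [hα0 _ hz₀])
    · have hc : ContinuousAt (α (x₀, 0)) 0 := (hαd _ hz₀ 0 (mem_of_mem_nhds h0)).continuousAt
      have hs' : s ∈ 𝓝 (α (x₀, 0) 0) := by rwa [hα0 _ hz₀]
      filter_upwards [h0, hc hs'] with t ht ht' using ⟨hαd _ hz₀ t ht, ht'⟩
    · rw [hf₀]
      exact hasDerivAt_const _ _
  obtain ⟨ε₁, hε₁, hconst⟩ := Metric.eventually_nhds_iff.1 hconst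
  set ε := min (ε₀ / 2) (ε₁ / 2) with hε
  have hεpos : 0 < ε := by positivity
  have hεε₀ : ε < ε₀ := (min_le_left _ _).trans_lt (by linarith)
  have hεε₁ : ε < ε₁ := (min_le_right _ _).trans_lt (by linarith)
  set L : ℝ := L' + 1
  have hL : 0 < L := by positivity
  -- Chosen so that κ L ε = 1/2. The time ε is already fixed; only the range ρ of initial velocities
  -- shrinks with κ.
  set κ : ℝ := 1 / (2 * L * ε) with hκ
  have hκpos : 0 < κ := by positivity
  -- The velocity component of f has zero strict derivative at the rest point, hence an arbitrarily
  -- small Lipschitz constant near it.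
  obtain ⟨N', hN', hstrict⟩ : ∃ N' ∈ 𝓝 (x₀, (0 : E)), ∀ z ∈ N', ∀ z' ∈ N',
      ‖(f z).2 - (f z').2‖ ≤ κ * ‖z - z'‖ := by
    have h1 : HasStrictFDerivAt f
        ((ContinuousLinearMap.inl ℝ E E).comp (ContinuousLinearMap.snd ℝ E E)) (x₀, 0) := by
      have := hf.hasStrictFDerivAt (by simp)
      rwa [hf'.fderiv] at this
    obtain ⟨N', hN', h2⟩ := h1.approximates_deriv_on_nhds (c := ⟨κ, hκpos.le⟩)
      (Or.inr (by exact_mod_cast hκpos))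
    refine ⟨N', hN', fun z hz z' hz' => ?_⟩
    have h3 := h2 z hz z' hz'
    refine le_trans ?_ h3
    refine le_trans (le_of_eq ?_) (norm_snd_le _)
    simp
  obtain ⟨ρ', hρ', hball⟩ := Metric.mem_nhds_iff.1 (Filter.inter_mem hN hN')
  set ρ := min (r : ℝ) (ρ' / L) with hρ
  have hρpos : 0 < ρ := lt_min hr (by positivity)
  have hmem : ∀ w ∈ Metric.ball (0 : E) ρ, (x₀, w) ∈ Metric.closedBall (x₀, (0 : E)) r := by
    intro w hw
    have : ‖w‖ < r := (mem_ball_zero_iff.1 hw).trans_le (min_le_left _ _)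
    simpa [Prod.dist_eq] using this.le
  have htime : ∀ t ∈ Icc 0 ε, t ∈ Ioo (-ε₀) ε₀ := fun t ht =>
    ⟨by linarith [ht.1], by linarith [ht.2]⟩
  have hlip : ∀ z ∈ Metric.closedBall (x₀, (0 : E)) r, ∀ z' ∈ Metric.closedBall (x₀, (0 : E)) r,
      ∀ t ∈ Icc 0 ε, ‖α z t - α z' t‖ ≤ L * ‖z - z'‖ := by
    intro z hz z' hz' t ht
    have h1 :=
      (hL' t ⟨by linarith [(htime t ht).1], by linarith [(htime t ht).2]⟩).norm_sub_le hz hz'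
    exact h1.trans (by gcongr; simp [L])
  have hNN : ∀ w ∈ Metric.ball (0 : E) ρ, ∀ t ∈ Icc 0 ε, α (x₀, w) t ∈ N ∩ N' := by
    intro w hw t ht
    apply hball
    have h1 := hlip _ (hmem w hw) _ hz₀ t ht
    rw [hconst (by rw [Real.dist_eq, sub_zero, abs_of_nonneg ht.1]; linarith [ht.2])] at h1
    rw [mem_ball_iff_norm]
    refine h1.trans_lt ?_
    have h2 : ‖w‖ < ρ' / L := (mem_ball_zero_iff.1 hw).trans_le (min_le_right _ _)
    rw [lt_div_iff₀ hL] at h2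
    simpa [Prod.norm_def, mul_comm] using h2
  refine ⟨ε, hεpos, ρ, hρpos, L, hL, fun w => α (x₀, w), fun w hw => hα0 _ (hmem w hw),
    hconst (by rwa [Real.dist_eq, sub_zero, abs_of_pos hεpos]),
    fun w hw t ht => hαd _ (hmem w hw) t (htime t ht), fun w hw t ht => (hNN w hw t ht).1,
    fun w hw v hv t ht => ?_, fun w hw v hv => ?_⟩
  · have := hlip _ (hmem w hw) _ (hmem v hv) t ht
    simpa [Prod.norm_def] using this
  set η : ℝ → E × E := fun t => α (x₀, w) t - α (x₀, v) t with hη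
  have hηd : ∀ t ∈ Icc 0 ε, HasDerivAt η (f (α (x₀, w) t) - f (α (x₀, v) t)) t := fun t ht =>
    (hαd _ (hmem w hw) t (htime t ht)).sub (hαd _ (hmem v hv) t (htime t ht))
  have hηn : ∀ t ∈ Icc 0 ε, ‖η t‖ ≤ L * ‖w - v‖ := by
    intro t ht
    have := hlip _ (hmem w hw) _ (hmem v hv) t ht
    simpa [Prod.norm_def, hη] using this
  have hη2 : ∀ t ∈ Icc 0 ε, HasDerivAt (fun t => (η t).2)
      ((f (α (x₀, w) t)).2 - (f (α (x₀, v) t)).2) t := fun t ht =>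
    (ContinuousLinearMap.snd ℝ E E).hasFDerivAt.comp_hasDerivAt t (hηd t ht)
  have hη1 : ∀ t ∈ Icc 0 ε, HasDerivAt (fun t => (η t).1) ((η t).2) t := fun t ht => by
    have := (ContinuousLinearMap.fst ℝ E E).hasFDerivAt.comp_hasDerivAt t (hηd t ht)
    have h2 : ContinuousLinearMap.fst ℝ E E (f (α (x₀, w) t) - f (α (x₀, v) t)) = (η t).2 := by
      simp [hfst, hη]
    rwa [h2] at this
  have hη0 : η 0 = (0, w - v) := by
    simp [hη, hα0 _ (hmem w hw), hα0 _ (hmem v hv)]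
  -- The difference of the velocities changes by at most ‖w - v‖ / 2 up to time ε; one more
  -- integration gives the estimate for the positions.
  have hstep2 : ∀ t ∈ Icc 0 ε, ‖(η t).2 - (w - v)‖ ≤ κ * (L * ‖w - v‖) * ε := by
    intro t ht
    have h1 := norm_image_sub_le_of_norm_deriv_le_segment'
      (f := fun t => (η t).2) (C := κ * (L * ‖w - v‖)) (a := 0) (b := ε)
      (fun t ht => (hη2 t ht).hasDerivWithinAt)
      (fun t ht => (hstrict _ (hNN w hw t ⟨ht.1, ht.2.le⟩).2 _ (hNN v hv t ⟨ht.1, ht.2.le⟩).2).trans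
        (by gcongr; exact hηn t ⟨ht.1, ht.2.le⟩)) t ht
    rw [hη0] at h1
    refine h1.trans ?_
    have : t - 0 ≤ ε := by linarith [ht.2]
    gcongr
  have hstep1 := norm_image_sub_le_of_norm_deriv_le_segment'
      (f := fun t => (η t).1 - t • (w - v)) (C := κ * (L * ‖w - v‖) * ε) (a := 0) (b := ε)
      (f' := fun t => (η t).2 - (w - v))
      (fun t ht => by
        have := (hη1 t ht).sub ((hasDerivAt_id t).smul_const (w - v))
        rw [one_smul] at this
        exact this.hasDerivWithinAt)
      (fun t ht => hstep2 t ⟨ht.1, ht.2.le⟩) ε ⟨hεpos.le, le_rfl⟩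
  rw [hη0] at hstep1
  have h3 : κ * (L * ‖w - v‖) * ε * (ε - 0) = ε / 2 * ‖w - v‖ := by
    rw [hκ]
    field_simp
    ring
  rw [h3] at hstep1
  simpa [hη] using hstep1

end LocalFlow

/-! ### Kinetic energy and momentum -/

section Energy

variable {E : Type*} [NormedAddCommGroup E] [NormedSpace ℝ E]
  {G : E → E →L[ℝ] E →L[ℝ] ℝ} {U : Set E}

/-- The kinetic energy of a metric. -/
def energy (G : E → E →L[ℝ] E →L[ℝ] ℝ) (z : E × E) : ℝ := G z.1 z.2 z.2

theorem contDiffAt_energy (hG : IsMetricOn G U) {z : E × E} (hz : z.1 ∈ U) :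
    ContDiffAt ℝ ∞ (energy G) z := by
  have h1 : ContDiffAt ℝ ∞ (fun z : E × E => G z.1) z := (hG.contDiffAt hz).comp z contDiffAt_fst
  exact (h1.clm_apply contDiffAt_snd).clm_apply contDiffAt_snd

theorem fderiv_energy (hG : IsMetricOn G U) {z : E × E} (hz : z.1 ∈ U) (ζ : E × E) :
    fderiv ℝ (energy G) z ζ = fderiv ℝ G z.1 ζ.1 z.2 z.2 + 2 * G z.1 z.2 ζ.2 := by
  have h1 : HasFDerivAt (fun z : E × E => G z.1)
      ((fderiv ℝ G z.1).comp (ContinuousLinearMap.fst ℝ E E)) z :=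
    (hG.hasFDerivAt hz).comp z hasFDerivAt_fst
  have h2 : HasFDerivAt (energy G) _ z :=
    (h1.clm_apply hasFDerivAt_snd).clm_apply hasFDerivAt_snd
  rw [h2.fderiv]
  simp only [add_apply, ContinuousLinearMap.comp_apply,
    ContinuousLinearMap.flip_apply, ContinuousLinearMap.coe_fst', ContinuousLinearMap.coe_snd']
  rw [hG.symm _ ζ.2 z.2]
  ring

variable [FiniteDimensional ℝ E]

/-- Conservation of energy: the derivative of G along the motion cancels the Christoffel term of the
acceleration. -/
theorem fderiv_energy_spray (hG : IsMetricOn G U) {z : E × E} (hz : z.1 ∈ U) :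
    fderiv ℝ (energy G) z (spray G z) = 0 := by
  rw [fderiv_energy hG hz, hG.symm]
  simp only [spray]
  rw [metric_geodesicAccel hG hz, koszul_self_apply hG hz]
  ring

/-- First variation: the derivative of the momentum along a variation field. -/
theorem hasDerivAt_momentum (hG : IsMetricOn G U) {z : ℝ → E × E} {η : ℝ → E × E} {η' : E} {t : ℝ}
    (hz : (z t).1 ∈ U) (hzd : HasDerivAt z (spray G (z t)) t)
    (hη : HasDerivAt η ((η t).2, η') t) :
    HasDerivAt (fun s => G (z s).1 (z s).2 (η s).1) (fderiv ℝ (energy G) (z t) (η t) / 2) t := by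
  have hz1 : HasDerivAt (fun s => (z s).1) (z t).2 t :=
    (ContinuousLinearMap.fst ℝ E E).hasFDerivAt.comp_hasDerivAt t hzd
  have hz2 : HasDerivAt (fun s => (z s).2) (geodesicAccel G (z t)) t :=
    (ContinuousLinearMap.snd ℝ E E).hasFDerivAt.comp_hasDerivAt t hzd
  have hη1 : HasDerivAt (fun s => (η s).1) (η t).2 t :=
    (ContinuousLinearMap.fst ℝ E E).hasFDerivAt.comp_hasDerivAt t hη
  have h1 : HasDerivAt (fun s => G (z s).1 (z s).2) (fderiv ℝ G (z t).1 (z t).2 (z t).2 +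
      G (z t).1 (geodesicAccel G (z t))) t :=
    hasDerivAt_clm_comp_apply (y := fun s => (z s).1) (hG.hasFDerivAt hz) hz1 hz2
  have h2 := h1.clm_apply hη1
  convert! h2 using 1
  rw [fderiv_energy hG hz, add_apply, metric_geodesicAccel hG hz, koszul_self_apply hG hz]
  ring

end Energy

/-! ### First variation and the local squared distance -/

section LocalDistance

variable {E : Type*} [NormedAddCommGroup E] [NormedSpace ℝ E]
  {G : E → E →L[ℝ] E →L[ℝ] ℝ} {U : Set E}

/-- Taylor estimate that needs only a Lipschitz derivative: on the segment the derivative differs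
from its value at x by at most K ‖y - x‖. -/
theorem norm_sub_sub_fderiv_le {F : Type*} [NormedAddCommGroup F] [NormedSpace ℝ F] {f : F → ℝ}
    {s : Set F} {K : NNReal} (hs : Convex ℝ s)
    (hf : ∀ x ∈ s, DifferentiableAt ℝ f x) (hK : LipschitzOnWith K (fderiv ℝ f) s) {x y : F}
    (hx : x ∈ s) (hy : y ∈ s) : |f y - f x - fderiv ℝ f x (y - x)| ≤ K * ‖y - x‖ ^ 2 := by
  have hseg := hs.segment_subset hx hy
  have := (convex_segment (𝕜 := ℝ) x y).norm_image_sub_le_of_norm_hasFDerivWithin_le'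
    (f := f) (f' := fderiv ℝ f) (φ := fderiv ℝ f x) (C := K * ‖y - x‖)
    (fun z hz => (hf z (hseg hz)).hasFDerivAt.hasFDerivWithinAt)
    (fun z hz => (hK.norm_sub_le (hseg hz) hx).trans (by
      gcongr
      exact norm_sub_le_of_mem_segment hz)) (left_mem_segment ℝ x y) (right_mem_segment ℝ x y)
  rw [Real.norm_eq_abs] at this
  linarith

/-- The image of a ball under a map close to a homothety is a neighbourhood. -/
theorem image_ball_mem_nhds [CompleteSpace E] {X : E → E} {ε ρ : ℝ} (hε : 0 < ε) (hρ : 0 < ρ)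
    (hX : ∀ w ∈ Metric.ball (0 : E) ρ, ∀ v ∈ Metric.ball (0 : E) ρ,
      ‖X w - X v - ε • (w - v)‖ ≤ ε / 2 * ‖w - v‖) : X '' Metric.ball 0 ρ ∈ 𝓝 (X 0) := by
  have h : ApproximatesLinearOn X (ε • ContinuousLinearMap.id ℝ E) (Metric.ball 0 ρ)
      (ε / 2).toNNReal := fun w hw v hv => by
    rw [Real.coe_toNNReal _ (by positivity)]
    exact hX w hw v hv
  let R : (ε • ContinuousLinearMap.id ℝ E).NonlinearRightInverse :=
    { toFun := fun y => ε⁻¹ • y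
      nnnorm := ε.toNNReal⁻¹
      bound' := fun y => by simp [norm_smul, abs_of_pos hε, hε.le]
      right_inv' := fun y => by simp [hε.ne'] }
  -- Surjectivity holds because the error ε/2 is less than ε, the reciprocal of the norm bound of
  -- the right inverse.
  refine h.image_mem_nhds R (Metric.ball_mem_nhds 0 hρ) (Or.inr ?_)
  simp only [R, inv_inv]
  exact (Real.toNNReal_lt_toNNReal_iff hε).2 (by linarith)

variable [FiniteDimensional ℝ E]

theorem energy_flow_const (hG : IsMetricOn G U) {z : ℝ → E × E} {ε : ℝ}
    (hz : ∀ t ∈ Icc 0 ε, (z t).1 ∈ U) (hzd : ∀ t ∈ Icc 0 ε, HasDerivAt z (spray G (z t)) t)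
    {t : ℝ} (ht : t ∈ Icc 0 ε) : energy G (z t) = energy G (z 0) := by
  have hd : ∀ t ∈ Icc 0 ε, HasDerivAt (fun t => energy G (z t)) 0 t := by
    intro t ht
    have h1 := ((contDiffAt_energy hG (hz t ht)).differentiableAt (by simp)).hasFDerivAt
    have h2 := h1.comp_hasDerivAt t (hzd t ht)
    rwa [fderiv_energy_spray hG (hz t ht)] at h2
  exact constant_of_has_deriv_right_zero (f := fun t => energy G (z t))
    (fun t ht => (hd t ht).continuousAt.continuousWithinAt)
    (fun t ht => (hd t ⟨ht.1, ht.2.le⟩).hasDerivWithinAt) t ht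

/-- The first variation of the energy of a geodesic, with a quadratic error term. -/
theorem first_variation (hG : IsMetricOn G U) {z ζ : ℝ → E × E} {ε C : ℝ} {K : NNReal}
    {s : Set (E × E)} (hε : 0 ≤ ε) (hsU : ∀ z ∈ s, z.1 ∈ U) (hs : Convex ℝ s)
    (hK : LipschitzOnWith K (fderiv ℝ (energy G)) s)
    (hz : ∀ t ∈ Icc 0 ε, z t ∈ s) (hzd : ∀ t ∈ Icc 0 ε, HasDerivAt z (spray G (z t)) t)
    (hζ : ∀ t ∈ Icc 0 ε, ζ t ∈ s) (hζd : ∀ t ∈ Icc 0 ε, HasDerivAt ζ (spray G (ζ t)) t)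
    (h0 : (z 0).1 = (ζ 0).1) (hC : ∀ t ∈ Icc 0 ε, ‖ζ t - z t‖ ≤ C) :
    |2 * G (z ε).1 (z ε).2 ((ζ ε).1 - (z ε).1) - ε * (energy G (ζ 0) - energy G (z 0))| ≤
      K * C ^ 2 * ε := by
  -- The momentum of z paired with the displacement to ζ. Its derivative is half the differential of
  -- the energy along the displacement, hence half the energy difference up to the Taylor remainder;
  -- the energies are constant in time, so integration is immediate.
  set B : ℝ → ℝ := fun t => G (z t).1 (z t).2 (ζ t - z t).1
  have hB : ∀ t ∈ Icc 0 ε, HasDerivAt B (fderiv ℝ (energy G) (z t) (ζ t - z t) / 2) t := by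
    intro t ht
    refine hasDerivAt_momentum hG (hsU _ (hz t ht)) (hzd t ht)
      (η := fun s => ζ s - z s) (η' := (spray G (ζ t) - spray G (z t)).2) ?_
    exact (hζd t ht).sub (hzd t ht)
  have hder : ∀ t ∈ Icc 0 ε, HasDerivAt
      (fun t => 2 * B t - t * (energy G (ζ 0) - energy G (z 0)))
      (fderiv ℝ (energy G) (z t) (ζ t - z t) - (energy G (ζ 0) - energy G (z 0))) t := by
    intro t ht
    have := ((hB t ht).const_mul 2).sub
      ((hasDerivAt_id t).mul_const (energy G (ζ 0) - energy G (z 0)))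
    convert! this using 1
    ring
  have hbound : ∀ t ∈ Icc 0 ε,
      ‖fderiv ℝ (energy G) (z t) (ζ t - z t) - (energy G (ζ 0) - energy G (z 0))‖ ≤
        K * C ^ 2 := by
    intro t ht
    rw [← energy_flow_const hG (fun t ht => hsU _ (hz t ht)) hzd ht,
      ← energy_flow_const hG (fun t ht => hsU _ (hζ t ht)) hζd ht, Real.norm_eq_abs, abs_sub_comm]
    refine (norm_sub_sub_fderiv_le hs (fun x hx =>
      (contDiffAt_energy hG (hsU x hx)).differentiableAt (by simp)) hK (hz t ht) (hζ t ht)).trans ?_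
    have := hC t ht
    gcongr
  have h1 := norm_image_sub_le_of_norm_deriv_le_segment' (a := 0) (b := ε)
    (fun t ht => (hder t ht).hasDerivWithinAt) (fun t ht => hbound t ⟨ht.1, ht.2.le⟩) ε
    ⟨hε, le_rfl⟩
  have hB0 : B 0 = 0 := by simp [B, h0]
  simp only [hB0, mul_zero, zero_mul, sub_zero] at h1
  exact h1

/-- Near `x₀` there is a smooth-enough squared distance function `G x₀ (R y) (R y)` with gradient of
the right length, and geodesics from `x₀` reach `y` when they start in the direction `R y`. -/
theorem exists_local_distance (hG : IsMetricOn G U) {x₀ : E} (hx₀ : x₀ ∈ U) :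
    ∃ r > 0, Metric.ball x₀ r ⊆ U ∧ ∃ R : E → E, R x₀ = 0 ∧
      (∀ y ∈ Metric.ball x₀ r, R y = 0 → y = x₀) ∧
      (∀ y ∈ Metric.ball x₀ r, ∃ F' : E →L[ℝ] ℝ, HasFDerivAt (fun y => G x₀ (R y) (R y)) F' y ∧
        ∀ h, (F' h) ^ 2 ≤ 4 * G x₀ (R y) (R y) * G y h h) ∧
      (∀ y ∈ Metric.ball x₀ r, ∀ ℓ > 0, ℓ ^ 2 = G x₀ (R y) (R y) → ∀ c c' : ℝ → E, c 0 = x₀ →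
        c' 0 = ℓ⁻¹ • R y → (∀ t ∈ Icc 0 ℓ, c t ∈ Metric.ball x₀ r ∧ HasDerivAt c (c' t) t ∧
          HasDerivAt c' (geodesicAccel G (c t, c' t)) t ∧ G (c t) (c' t) (c' t) = 1) →
        c ℓ = y) := by
  obtain ⟨m, hm, hmG⟩ := hG.exists_lower_bound hx₀
  obtain ⟨K, s, hs, hK⟩ : ∃ K, ∃ s ∈ 𝓝 (x₀, (0 : E)), LipschitzOnWith K (fderiv ℝ (energy G)) s :=
    (((contDiffAt_energy hG (z := (x₀, 0)) hx₀).fderiv_right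
      (m := 1) (by norm_cast)).exists_lipschitzOnWith)
  obtain ⟨K', s', hs', hK'⟩ := (contDiffAt_spray hG hx₀ 0).exists_lipschitzOnWith
  have hU : U ×ˢ univ ∈ 𝓝 (x₀, (0 : E)) := (hG.isOpen.prod isOpen_univ).mem_nhds ⟨hx₀, trivial⟩
  obtain ⟨r₁, hr₁, hball⟩ := Metric.mem_nhds_iff.1
    (Filter.inter_mem (Filter.inter_mem hs hs') hU)
  have hBs : Metric.ball (x₀, (0 : E)) r₁ ⊆ s := fun z hz => (hball hz).1.1
  have hBs' : Metric.ball (x₀, (0 : E)) r₁ ⊆ s' := fun z hz => (hball hz).1.2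
  have hBU : ∀ z ∈ Metric.ball (x₀, (0 : E)) r₁, z.1 ∈ U := fun z hz => (hball hz).2.1
  have hspray0 : spray G (x₀, 0) = 0 := by
    have := geodesicAccel_smul (G := G) (x := x₀) 0 0
    simp only [spray]
    simp_all
  obtain ⟨ε, hε, ρ, hρ, L, hL, Z, hZ0, hZz, hZd, hZB, hZL, hZX⟩ := exists_local_flow
    (contDiffAt_spray hG hx₀ 0) hspray0 (hasFDerivAt_spray_zero hG hx₀)
    (fun z => rfl) (Metric.ball_mem_nhds (x₀, (0 : E)) hr₁)
  set X : E → E := fun w => (Z w ε).1 with hX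
  have hεI : ε ∈ Icc 0 ε := ⟨hε.le, le_rfl⟩
  have h0I : (0 : ℝ) ∈ Icc 0 ε := ⟨le_rfl, hε.le⟩
  have hX0 : X 0 = x₀ := by simp [hX, hZz]
  have h0ρ : (0 : E) ∈ Metric.ball (0 : E) ρ := Metric.mem_ball_self hρ
  -- X is within ε/2 of the homothety by ε, so it is injective with a Lipschitz inverse.
  have hanti : ∀ w ∈ Metric.ball (0 : E) ρ, ∀ v ∈ Metric.ball (0 : E) ρ,
      ‖w - v‖ ≤ 2 / ε * ‖X w - X v‖ := by
    intro w hw v hv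
    have h1 := hZX w hw v hv
    have h2 : ‖ε • (w - v)‖ ≤ ‖X w - X v‖ + ‖X w - X v - ε • (w - v)‖ := by
      rw [norm_sub_rev (X w - X v)]
      exact norm_le_insert' _ _
    rw [norm_smul, Real.norm_of_nonneg hε.le] at h2
    have h3 : ε / 2 * ‖w - v‖ ≤ ‖X w - X v‖ := by linarith
    calc ‖w - v‖ = 2 / ε * (ε / 2 * ‖w - v‖) := by field_simp
      _ ≤ _ := by gcongr
  have himg := image_ball_mem_nhds hε hρ hZX
  rw [show (Z 0 ε).1 = x₀ from hX0] at himg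
  -- Chosen so that ‖w‖ ≤ r₁ q forces G x₀ w w < r₁² m; this keeps the rescaled velocity of the
  -- competing curve inside the ball of radius r₁.
  set q : ℝ := √(m / (‖G x₀‖ + 1)) with hq
  have hqpos : 0 < q := Real.sqrt_pos.2 (by positivity)
  obtain ⟨r₂, hr₂, hball₂⟩ := Metric.mem_nhds_iff.1 (Filter.inter_mem himg
    (Filter.inter_mem hmG (hG.isOpen.mem_nhds hx₀)))
  set r := min r₂ (min r₁ (r₁ * ε / 2 * q)) with hr
  have hrpos : 0 < r := by positivity
  have hsub : ∀ y ∈ Metric.ball x₀ r, y ∈ X '' Metric.ball 0 ρ ∧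
      (∀ h, m * ‖h‖ ^ 2 ≤ G y h h) ∧ y ∈ U := fun y hy =>
    ⟨(hball₂ (Metric.ball_subset_ball (min_le_left _ _) hy)).1,
      (hball₂ (Metric.ball_subset_ball (min_le_left _ _) hy)).2⟩
  -- W y is the initial velocity that reaches y at time ε, so R y = ε W y is the inverse exponential
  -- map and G x₀ (R y) (R y) is the squared length of the radial geodesic.
  set W : E → E := Function.invFunOn X (Metric.ball 0 ρ) with hW
  have hWmem : ∀ y ∈ Metric.ball x₀ r, W y ∈ Metric.ball (0 : E) ρ := fun y hy =>
    Function.invFunOn_mem (hsub y hy).1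
  have hXW : ∀ y ∈ Metric.ball x₀ r, X (W y) = y := fun y hy =>
    Function.invFunOn_eq (hsub y hy).1
  have hx₀r : x₀ ∈ Metric.ball x₀ r := Metric.mem_ball_self hrpos
  have hW0 : W x₀ = 0 := by
    have := hanti _ (hWmem x₀ hx₀r) 0 h0ρ
    rw [hXW x₀ hx₀r, hX0] at this
    simpa using this
  have hen : ∀ w ∈ Metric.ball (0 : E) ρ, ∀ t ∈ Icc 0 ε, energy G (Z w t) = G x₀ w w := by
    intro w hw t ht
    rw [energy_flow_const hG (fun t ht => hBU _ (hZB w hw t ht)) (hZd w hw) ht, hZ0 w hw]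
    rfl
  refine ⟨r, hrpos, fun y hy => (hsub y hy).2.2, fun y => ε • W y, by simp [hW0],
    fun y hy hy0 => ?_, fun y hy => ?_, fun y hy ℓ hℓ hℓF c c' hc0 hc'0 hc => ?_⟩
  · rw [smul_eq_zero_iff_right hε.ne'] at hy0
    rw [← hXW y hy, hy0, hX0]
  · have hv := hWmem y hy
    have hXv := hXW y hy
    set v := W y with hvdef
    -- Gauss lemma: the gradient is a multiple of the final velocity. By the first variation the
    -- remainder is quadratic in w - v, hence in y' - y by the Lipschitz inverse; W itself need not
    -- be differentiable.
    refine ⟨(2 * ε) • G y (Z v ε).2, ?_, fun h => ?_⟩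
    · rw [hasFDerivAt_iff_isLittleO]
      have hO : (fun y' => G x₀ (ε • W y') (ε • W y') - G x₀ (ε • W y) (ε • W y) -
          ((2 * ε) • G y (Z v ε).2) (y' - y)) =O[𝓝 y] fun y' => ‖y' - y‖ ^ 2 := by
        refine Asymptotics.IsBigO.of_bound (ε * (K * (L * (2 / ε)) ^ 2 * ε)) ?_
        filter_upwards [Metric.isOpen_ball.mem_nhds hy] with y' hy'
        have hw := hWmem y' hy'
        have hXw := hXW y' hy'
        set w := W y'
        have h1 := first_variation hG hε.le hBU (convex_ball (x₀, (0 : E)) r₁) (hK.mono hBs)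
          (hZB v hv) (hZd v hv) (hZB w hw) (hZd w hw) (by rw [hZ0 v hv, hZ0 w hw])
          (hZL w hw v hv)
        rw [hen w hw 0 h0I, hen v hv 0 h0I, show (Z w ε).1 = y' from hXw,
          show (Z v ε).1 = y from hXv] at h1
        have h2 := hanti w hw v hv
        rw [hXw, hXv] at h2
        rw [← hvdef]
        simp only [map_smul, smul_apply, smul_eq_mul]
        have h3 : ε * (ε * G x₀ w w) - ε * (ε * G x₀ v v) - 2 * ε * G y (Z v ε).2 (y' - y) =
            -(ε * (2 * G y (Z v ε).2 (y' - y) - ε * (G x₀ w w - G x₀ v v))) := by ring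
        rw [h3, norm_neg, norm_mul, Real.norm_of_nonneg hε.le, Real.norm_eq_abs, norm_pow,
          norm_norm]
        calc ε * |2 * G y (Z v ε).2 (y' - y) - ε * (G x₀ w w - G x₀ v v)|
            ≤ ε * (K * (L * ‖w - v‖) ^ 2 * ε) := by gcongr
          _ ≤ ε * (K * (L * (2 / ε * ‖y' - y‖)) ^ 2 * ε) := by gcongr
          _ = _ := by ring
      exact hO.trans_isLittleO (Asymptotics.isLittleO_pow_sub_sub y one_lt_two)
    -- Cauchy–Schwarz, where conservation of energy replaces the squared final speed by G x₀ v v.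
    · have h1 := hG.cauchySchwarz (hsub y hy).2.2 (Z v ε).2 h
      have h2 := hen v hv ε hεI
      rw [energy, show (Z v ε).1 = y from hXv] at h2
      rw [h2] at h1
      simp only [map_smul, smul_apply, smul_eq_mul]
      calc (2 * ε * G y (Z v ε).2 h) ^ 2 = 4 * ε ^ 2 * (G y (Z v ε).2 h) ^ 2 := by ring
        _ ≤ 4 * ε ^ 2 * (G x₀ v v * G y h h) := by gcongr
        _ = _ := by ring
  · have hw := hWmem y hy
    have hXw := hXW y hy
    set w := W y
    set k := ℓ / ε with hk
    have hkpos : 0 < k := by positivity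
    have hk2 : k ^ 2 = G x₀ w w := by
      rw [hk, div_pow, hℓF]
      simp only [map_smul, smul_apply, smul_eq_mul]
      field_simp
      rfl
    have hkr : k < r₁ * √m := by
      have h1 : ‖w‖ ≤ r₁ * q := by
        have h2 := hanti w hw 0 h0ρ
        rw [sub_zero, hXw, hX0] at h2
        have h3 : ‖y - x₀‖ ≤ r₁ * ε / 2 * q :=
          (mem_ball_iff_norm.1 hy).le.trans ((min_le_right _ _).trans (min_le_right _ _))
        calc ‖w‖ ≤ 2 / ε * ‖y - x₀‖ := h2
          _ ≤ 2 / ε * (r₁ * ε / 2 * q) := by gcongr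
          _ = r₁ * q := by field_simp
      refine lt_of_pow_lt_pow_left₀ 2 (by positivity) ?_
      have hq2 : (‖G x₀‖ + 1) * q ^ 2 = m := by
        rw [hq, Real.sq_sqrt (by positivity)]
        field_simp
      calc k ^ 2 = G x₀ w w := hk2
        _ ≤ ‖G x₀‖ * ‖w‖ * ‖w‖ := (le_abs_self _).trans ((G x₀).le_opNorm₂ w w)
        _ ≤ ‖G x₀‖ * (r₁ * q) * (r₁ * q) := by gcongr
        _ < (‖G x₀‖ + 1) * (r₁ * q) * (r₁ * q) := by gcongr; linarith
        _ = r₁ ^ 2 * ((‖G x₀‖ + 1) * q ^ 2) := by ring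
        _ = (r₁ * √m) ^ 2 := by rw [hq2, mul_pow, Real.sq_sqrt hm.le]
    have hmemI : ∀ t ∈ Icc 0 ε, k * t ∈ Icc 0 ℓ := fun t ht => by
      refine ⟨mul_nonneg hkpos.le ht.1, ?_⟩
      calc k * t ≤ k * ε := by gcongr; exact ht.2
        _ = ℓ := by rw [hk]; field_simp
    -- The unit speed curve run at speed k = ℓ / ε: it starts with velocity W y and arrives at time
    -- ε, so uniqueness for the spray identifies it with Z w.
    set ζ : ℝ → E × E := fun t => (c (k * t), k • c' (k * t)) with hζ
    have hζd : ∀ t ∈ Icc 0 ε, HasDerivAt ζ (spray G (ζ t)) t := by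
      intro t ht
      obtain ⟨-, h1, h2, -⟩ := hc _ (hmemI t ht)
      have hlin : HasDerivAt (fun t => k * t) k t := by
        simpa using (hasDerivAt_id t).const_mul k
      have h3 := (h1.scomp t hlin).prodMk ((h2.scomp t hlin).const_smul k)
      convert! h3 using 1
      simp only [spray, hζ, geodesicAccel_smul]
      rw [smul_smul, sq]
    have hζB : ∀ t ∈ Icc 0 ε, ζ t ∈ Metric.ball (x₀, (0 : E)) r₁ := by
      intro t ht
      obtain ⟨h0, -, -, h1⟩ := hc _ (hmemI t ht)
      rw [← ball_prod_same]
      refine ⟨Metric.ball_subset_ball ((min_le_right _ _).trans (min_le_left _ _)) h0, ?_⟩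
      rw [mem_ball_zero_iff, norm_smul, Real.norm_of_nonneg hkpos.le]
      have h2 := (hsub _ h0).2.1 (c' (k * t))
      rw [h1] at h2
      have h3 : √m * ‖c' (k * t)‖ ≤ 1 := by
        refine abs_le_of_sq_le_sq' ?_ zero_le_one |>.2
        rw [mul_pow, Real.sq_sqrt hm.le]
        linarith
      have hsm : 0 < √m := Real.sqrt_pos.2 hm
      rcases (norm_nonneg (c' (k * t))).eq_or_lt with h4 | h4
      · rw [← h4]; simpa using hr₁
      calc k * ‖c' (k * t)‖ < r₁ * √m * ‖c' (k * t)‖ := by gcongr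
        _ = r₁ * (√m * ‖c' (k * t)‖) := by ring
        _ ≤ r₁ * 1 := by gcongr
        _ = r₁ := mul_one _
    have huniq := ODE_solution_unique_of_mem_Icc_right (v := fun _ => spray G)
      (s := fun _ => Metric.ball (x₀, (0 : E)) r₁) (K := K') (a := 0) (b := ε) (f := ζ) (g := Z w)
      (fun _ _ => hK'.mono hBs') (fun t ht => (hζd t ht).continuousAt.continuousWithinAt)
      (fun t ht => (hζd t ⟨ht.1, ht.2.le⟩).hasDerivWithinAt) (fun t ht => hζB t ⟨ht.1, ht.2.le⟩)
      (fun t ht => (hZd w hw t ht).continuousAt.continuousWithinAt)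
      (fun t ht => (hZd w hw t ⟨ht.1, ht.2.le⟩).hasDerivWithinAt)
      (fun t ht => hZB w hw t ⟨ht.1, ht.2.le⟩) (by
        rw [hZ0 w hw]
        simp only [hζ, mul_zero, hc0, hc'0]
        rw [smul_smul, smul_smul, hk]
        field_simp
        simp
        rfl) hεI
    have h5 : (ζ ε).1 = y := by rw [huniq]; exact hXw
    rw [← h5]
    simp only [hζ, hk]
    rw [div_mul_cancel₀ _ hε.ne']

end LocalDistance

/-! ### Geodesics in charts, lengths of paths and local minimality -/

section Geodesics

variable {n : ℕ} {M : Type*} [MetricSpace M] [ChartedSpace (EuclideanSpace ℝ (Fin n)) M]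
  [IsManifold (𝓡 n) ∞ M] [RiemannianBundle (fun x : M => TangentSpace (𝓡 n) x)]

theorem contMDiff_unitField :
    ContMDiff 𝓘(ℝ, ℝ) 𝓘(ℝ, ℝ).tangent ∞
      (fun t : ℝ => (⟨t, (1 : ℝ)⟩ : TangentBundle 𝓘(ℝ, ℝ) ℝ)) := by
  rw [← contMDiffOn_univ]
  exact contMDiffOn_vectorSpace_iff_contDiffOn.2 contDiffOn_const

theorem tangentCoord_zero (p q : M) :
    tangentCoord p (⟨q, (0 : TangentSpace (𝓡 n) q)⟩ : TangentBundle (𝓡 n) M) = 0 :=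
  map_zero (tangentCoordChange (𝓡 n) q p q)

theorem norm_sq_eq_chartMetric_self (p : M) (X : TangentSpace (𝓡 n) p) :
    ‖X‖ ^ 2 = chartMetric n p (extChartAt (𝓡 n) p p) X X := by
  have h := norm_sq_eq_chartMetric (p := p) (V := (⟨p, X⟩ : TangentBundle (𝓡 n) M))
    (mem_chart_source _ p)
  have e : tangentCoord p (⟨p, X⟩ : TangentBundle (𝓡 n) M) = X := tangentCoord_self p X
  exact h.trans (by simp only [e])

theorem continuous_velocity {γ : ℝ → M} (hγ : ContMDiff 𝓘(ℝ, ℝ) (𝓡 n) 1 γ) :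
    Continuous (velocity n γ) := by
  have : IsManifold (𝓡 n) 1 M := .of_le (n := ∞) (by simp)
  exact (hγ.continuous_tangentMap le_rfl).comp contMDiff_unitField.continuous

theorem contMDiff_velocity {γ : ℝ → M} (hγ : ContMDiff 𝓘(ℝ, ℝ) (𝓡 n) ∞ γ) :
    ContMDiff 𝓘(ℝ, ℝ) (𝓡 n).tangent ∞ (velocity n γ) :=
  (hγ.contMDiff_tangentMap (by simp)).comp contMDiff_unitField

variable [IsContMDiffRiemannianBundle (𝓡 n) ∞ (EuclideanSpace ℝ (Fin n))
      (fun x : M => TangentSpace (𝓡 n) x)]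

theorem isMetricOn_chartMetric (p : M) :
    IsMetricOn (chartMetric n p) (extChartAt (𝓡 n) p).target where
  isOpen := isOpen_extChartAt_target p
  contDiffOn := contDiffOn_chartMetric p
  symm := chartMetric_symm p
  pos _ hx _ ha := chartMetric_pos hx ha

theorem continuous_speed {γ : ℝ → M} (hγ : ContMDiff 𝓘(ℝ, ℝ) (𝓡 n) 1 γ) :
    Continuous fun t => ‖(velocity n γ t).2‖ := by
  have : IsContinuousRiemannianBundle (EuclideanSpace ℝ (Fin n))
      (fun x : M => TangentSpace (𝓡 n) x) := by
    obtain ⟨g, hg, hg'⟩ := IsContMDiffRiemannianBundle.exists_contMDiff (IB := 𝓡 n) (n := ∞)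
      (F := EuclideanSpace ℝ (Fin n)) (E := fun x : M => TangentSpace (𝓡 n) x)
    exact ⟨⟨g, hg.continuous, hg'⟩⟩
  have h := continuous_velocity hγ
  have h2 := Continuous.inner_bundle (F := EuclideanSpace ℝ (Fin n))
    (E := fun x : M => TangentSpace (𝓡 n) x) (v := fun t => (velocity n γ t).2)
    (w := fun t => (velocity n γ t).2) h h
  have h3 : (fun t => ‖(velocity n γ t).2‖) =
      fun t => √(inner ℝ (velocity n γ t).2 (velocity n γ t).2) := by
    ext t
    exact norm_eq_sqrt_real_inner _
  rw [h3]
  exact h2.sqrt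

/-- The geodesic equation in any chart: a vanishing covariant derivative, tested against all w,
determines the acceleration because the metric is nondegenerate. -/
theorem IsGeodesic.hasDerivAt_chart {γ : ℝ → M} (hγ : IsGeodesic n γ) {p : M} {t : ℝ}
    (hp : γ t ∈ (chartAt (EuclideanSpace ℝ (Fin n)) p).source) :
    HasDerivAt (fun s => extChartAt (𝓡 n) p (γ s)) (tangentCoord p (velocity n γ t)) t ∧
    HasDerivAt (fun s => tangentCoord p (velocity n γ s))
      (geodesicAccel (chartMetric n p)
        (extChartAt (𝓡 n) p (γ t), tangentCoord p (velocity n γ t))) t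
    ∧ chartMetric n p (extChartAt (𝓡 n) p (γ t)) (tangentCoord p (velocity n γ t))
      (tangentCoord p (velocity n γ t)) = 1 := by
  have hV : MDifferentiableAt 𝓘(ℝ, ℝ) (𝓡 n).tangent (velocity n γ) t :=
    (contMDiff_velocity hγ.smooth).mdifferentiable (by simp) t
  have h1 := hasDerivAt_extChartAt_comp (hγ.smooth.mdifferentiable (by simp) t) hp
  obtain ⟨y', u', hy, hu, -, hK⟩ := connectionMap_coord hV (p := p) hp
  have hy' : y' = tangentCoord p (velocity n γ t) := HasDerivAt.unique hy h1
  have ht : extChartAt (𝓡 n) p (γ t) ∈ (extChartAt (𝓡 n) p).target :=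
    (extChartAt (𝓡 n) p).map_source (by simpa using hp)
  refine ⟨h1, ?_, ?_⟩
  · have h0 : tangentCoord p ⟨γ t, connectionMap (velocity n γ t)
        (mfderiv 𝓘(ℝ, ℝ) (𝓡 n).tangent (velocity n γ) t (1 : ℝ))⟩ = 0 :=
      (congrArg (fun X : TangentSpace (𝓡 n) (γ t) => tangentCoord p ⟨γ t, X⟩)
        (hγ.covDeriv_eq_zero t)).trans (tangentCoord_zero p _)
    have hu' : u' = geodesicAccel (chartMetric n p)
        (extChartAt (𝓡 n) p (γ t), tangentCoord p (velocity n γ t)) := by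
      refine eq_geodesicAccel (isMetricOn_chartMetric p) ht fun w => ?_
      have h2 := hK w
      have h3 : chartMetric n p (extChartAt (𝓡 n) p (γ t)) (tangentCoord p ⟨γ t,
          connectionMap (velocity n γ t)
            (mfderiv 𝓘(ℝ, ℝ) (𝓡 n).tangent (velocity n γ) t (1 : ℝ))⟩) w = 0 := by
        rw [h0]; simp
      have h4 := h3.symm.trans h2
      rw [hy'] at h4
      exact eq_neg_of_add_eq_zero_left h4.symm
    rw [← hu']
    exact hu
  · have := norm_sq_eq_chartMetric (V := velocity n γ t) hp
    rw [hγ.unit_speed t, one_pow] at this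
    exact this.symm

variable [IsRiemannianManifold (𝓡 n) M]

omit [IsContMDiffRiemannianBundle (𝓡 n) ∞ (EuclideanSpace ℝ (Fin n))
      (fun x : M => TangentSpace (𝓡 n) x)] [IsManifold (𝓡 n) ∞ M] in
theorem dist_le_of_speed_le {γ : ℝ → M} {a b K : ℝ} (hab : a ≤ b)
    (hγ : ContMDiffOn 𝓘(ℝ, ℝ) (𝓡 n) 1 γ (Icc a b)) (hK0 : 0 ≤ K)
    (hK : ∀ t ∈ Ioo a b, ‖(velocity n γ t).2‖ ≤ K) : dist (γ a) (γ b) ≤ K * (b - a) := by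
  rw [← ENNReal.ofReal_le_ofReal_iff (mul_nonneg hK0 (sub_nonneg.2 hab)), ← edist_dist,
    IsRiemannianManifold.out (I := 𝓡 n)]
  refine (riemannianEDist_le_pathELength hγ rfl rfl hab).trans ?_
  rw [pathELength_eq_lintegral_mfderiv_Ioo]
  calc _ ≤ ∫⁻ t in Ioo a b, ENNReal.ofReal K := by
        refine setLIntegral_mono measurable_const fun t ht => ?_
        rw [← ofReal_norm]
        exact ENNReal.ofReal_le_ofReal (hK t ht)
    _ = _ := by
        rw [setLIntegral_const, Real.volume_Ioo, ENNReal.ofReal_mul hK0]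

omit [IsContMDiffRiemannianBundle (𝓡 n) ∞ (EuclideanSpace ℝ (Fin n))
      (fun x : M => TangentSpace (𝓡 n) x)] in
theorem IsGeodesic.dist_le {γ : ℝ → M} (hγ : IsGeodesic n γ) (s t : ℝ) :
    dist (γ s) (γ t) ≤ |s - t| := by
  wlog h : s ≤ t generalizing s t
  · rw [dist_comm, abs_sub_comm]
    exact this t s (not_le.1 h).le
  · have := dist_le_of_speed_le h (hγ.smooth.of_le (by simp)).contMDiffOn zero_le_one
      fun t _ => (hγ.unit_speed t).le
    rw [abs_sub_comm, abs_of_nonneg (sub_nonneg.2 h)]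
    linarith

theorem lintegral_speed {γ : ℝ → M} (hγ : ContMDiff 𝓘(ℝ, ℝ) (𝓡 n) 1 γ) {a b : ℝ} (hab : a ≤ b) :
    pathELength (𝓡 n) γ a b = ENNReal.ofReal (∫ t in a..b, ‖(velocity n γ t).2‖) := by
  rw [intervalIntegral.integral_of_le hab, ofReal_integral_eq_lintegral_ofReal]
  · rw [pathELength_eq_lintegral_mfderiv_Icc, restrict_Ioc_eq_restrict_Icc]
    refine lintegral_congr fun t => ?_
    rw [ofReal_norm]
    rfl
  · rw [← IntegrableOn, ← integrableOn_Icc_iff_integrableOn_Ioc]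
    exact (continuous_speed hγ).integrableOn_Icc
  · exact Filter.Eventually.of_forall fun t => norm_nonneg _

theorem dist_le_integral_speed {γ : ℝ → M} (hγ : ContMDiff 𝓘(ℝ, ℝ) (𝓡 n) 1 γ) {a b : ℝ}
    (hab : a ≤ b) : dist (γ a) (γ b) ≤ ∫ t in a..b, ‖(velocity n γ t).2‖ := by
  rw [← ENNReal.ofReal_le_ofReal_iff
    (intervalIntegral.integral_nonneg hab fun t _ => norm_nonneg _), ← edist_dist,
    IsRiemannianManifold.out (I := 𝓡 n), ← lintegral_speed hγ hab]
  exact riemannianEDist_le_pathELength hγ.contMDiffOn rfl rfl hab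

theorem exists_path_of_dist_lt {x y : M} {r : ℝ} (h : dist x y < r) :
    ∃ γ : ℝ → M, ContMDiff 𝓘(ℝ, ℝ) (𝓡 n) 1 γ ∧ γ 0 = x ∧ γ 1 = y ∧
      ∫ t in (0 : ℝ)..1, ‖(velocity n γ t).2‖ < r := by
  have h' : riemannianEDist (𝓡 n) x y < ENNReal.ofReal r := by
    rw [← IsRiemannianManifold.out (I := 𝓡 n), edist_dist]
    exact (ENNReal.ofReal_lt_ofReal_iff (dist_nonneg.trans_lt h)).2 h
  obtain ⟨γ, h0, h1, hγ, hl, -⟩ := exists_lt_locally_constant_of_riemannianEDist_lt h' zero_lt_one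
  refine ⟨γ, hγ, h0, h1, ?_⟩
  rw [lintegral_speed hγ zero_le_one] at hl
  exact (ENNReal.ofReal_lt_ofReal_iff (dist_nonneg.trans_lt h)).1 hl

theorem integral_speed_add {γ : ℝ → M} (hγ : ContMDiff 𝓘(ℝ, ℝ) (𝓡 n) 1 γ)
    {a b c : ℝ} : (∫ t in a..b, ‖(velocity n γ t).2‖) + (∫ t in b..c, ‖(velocity n γ t).2‖) =
      ∫ t in a..c, ‖(velocity n γ t).2‖ :=
  intervalIntegral.integral_add_adjacent_intervals ((continuous_speed hγ).intervalIntegrable _ _)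
    ((continuous_speed hγ).intervalIntegrable _ _)

/-- Along a path the square root of a function whose gradient satisfies the eikonal inequality
grows at most by the length of the path. -/
theorem sqrt_le_of_eikonal {γ : ℝ → M} (hγ : ContMDiff 𝓘(ℝ, ℝ) (𝓡 n) 1 γ) {p : M}
    {F : EuclideanSpace ℝ (Fin n) → ℝ} {B : Set (EuclideanSpace ℝ (Fin n))}
    (hF0 : ∀ y ∈ B, 0 ≤ F y)
    (hF : ∀ y ∈ B, ∃ F' : EuclideanSpace ℝ (Fin n) →L[ℝ] ℝ, HasFDerivAt F F' y ∧
      ∀ h, (F' h) ^ 2 ≤ 4 * F y * chartMetric n p y h h)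
    (hγB : ∀ t ∈ Icc (0 : ℝ) 1, γ t ∈ (chartAt (EuclideanSpace ℝ (Fin n)) p).source ∧
      extChartAt (𝓡 n) p (γ t) ∈ B) (h0 : F (extChartAt (𝓡 n) p (γ 0)) = 0) :
    √(F (extChartAt (𝓡 n) p (γ 1))) ≤ ∫ t in (0 : ℝ)..1, ‖(velocity n γ t).2‖ := by
  refine le_of_forall_pos_le_add fun ε hε => ?_
  choose! F' hF' hF'le using hF
  set y := fun t => extChartAt (𝓡 n) p (γ t)
  -- The shift by ε² makes the square root differentiable where F vanishes, in particular at the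
  -- start.
  set g := fun t => √(F (y t) + ε ^ 2)
  set g' := fun t => F' (y t) (tangentCoord p (velocity n γ t)) / (2 * √(F (y t) + ε ^ 2))
  have hpos : ∀ t ∈ Icc (0 : ℝ) 1, 0 < F (y t) + ε ^ 2 := fun t ht => by
    have := hF0 _ (hγB t ht).2
    positivity
  have hg : ∀ t ∈ Icc (0 : ℝ) 1, HasDerivAt g (g' t) t := by
    intro t ht
    have h1 : HasDerivAt y (tangentCoord p (velocity n γ t)) t :=
      hasDerivAt_extChartAt_comp (hγ.mdifferentiable one_ne_zero t) (hγB t ht).1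
    have h2 : HasDerivAt (fun t => F (y t)) (F' (y t) (tangentCoord p (velocity n γ t))) t :=
      HasFDerivAt.comp_hasDerivAt (E := ℝ) t (hF' _ (hγB t ht).2) h1
    exact (h2.add_const (ε ^ 2)).sqrt (hpos t ht).ne'
  have key := intervalIntegral.sub_le_integral_of_hasDeriv_right_of_le zero_le_one
    (fun t ht => (hg t ht).continuousAt.continuousWithinAt)
    (fun t ht => (hg t ⟨ht.1.le, ht.2.le⟩).hasDerivWithinAt)
    (continuous_speed (n := n) hγ).integrableOn_Icc (fun t ht => by
      have ht' : t ∈ Icc (0 : ℝ) 1 := ⟨ht.1.le, ht.2.le⟩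
      have hs := Real.sqrt_pos.2 (hpos t ht')
      simp only [g']
      rw [div_le_iff₀ (by positivity)]
      refine le_of_abs_le (abs_le_of_sq_le_sq ?_ (by positivity)) 
      have h3 := hF'le _ (hγB t ht').2 (tangentCoord p (velocity n γ t))
      have h4 := norm_sq_eq_chartMetric (V := velocity n γ t) (hγB t ht').1
      have h5 : (F' (y t) (tangentCoord p (velocity n γ t))) ^ 2 ≤
        4 * F (y t) * ‖(velocity n γ t).2‖ ^ 2 := by
        rw [h4]; exact h3
      have h6 := Real.sq_sqrt (hpos t ht').le
      calc _ ≤ 4 * F (y t) * ‖(velocity n γ t).2‖ ^ 2 := h5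
        _ ≤ 4 * (F (y t) + ε ^ 2) * ‖(velocity n γ t).2‖ ^ 2 := by
          gcongr
          exact le_add_of_nonneg_right (by positivity)
        _ = 4 * √(F (y t) + ε ^ 2) ^ 2 * ‖(velocity n γ t).2‖ ^ 2 := by rw [h6]
        _ = _ := by ring)
  have h7 : g 0 = ε := by
    simp only [g, y, h0, zero_add]
    exact Real.sqrt_sq hε.le
  have h8 : √(F (y 1)) ≤ g 1 := Real.sqrt_le_sqrt (le_add_of_nonneg_right (by positivity))
  rw [h7] at key
  change √(F (y 1)) ≤ _
  linarith

theorem exists_ball_subset_chart (p : M) {r : ℝ} (hr : 0 < r) :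
    ∃ δ > 0, ∀ q, dist p q < δ → q ∈ (chartAt (EuclideanSpace ℝ (Fin n)) p).source ∧
      extChartAt (𝓡 n) p q ∈ Metric.ball (extChartAt (𝓡 n) p p) r := by
  have h1 : (chartAt (EuclideanSpace ℝ (Fin n)) p).source ∩
      extChartAt (𝓡 n) p ⁻¹' Metric.ball (extChartAt (𝓡 n) p p) r ∈ 𝓝 p :=
    Filter.inter_mem (chart_source_mem_nhds _ p)
      ((continuousAt_extChartAt p).preimage_mem_nhds (Metric.ball_mem_nhds _ hr))
  obtain ⟨δ, hδ, hball⟩ := Metric.mem_nhds_iff.1 h1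
  exact ⟨δ, hδ, fun q hq => hball (by rwa [Metric.mem_ball'])⟩

/-- Points close to `p` are reached by a minimal geodesic from `p`, as soon as the geodesic with
the right initial velocity exists. -/
theorem exists_local_direction (p : M) : ∃ δ > 0, ∀ q, q ≠ p → dist p q < δ →
    ∃ w : TangentSpace (𝓡 n) p, ‖w‖ = 1 ∧ ∀ (γ : ℝ → M) (t₀ : ℝ), IsGeodesic n γ →
      velocity n γ t₀ = ⟨p, w⟩ → γ (t₀ + dist p q) = q := by
  obtain ⟨r, hr, hrU, R, hR0, hRne, hRd, hRg⟩ := exists_local_distance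
    (isMetricOn_chartMetric (n := n) p) (mem_extChartAt_target p)
  obtain ⟨δ, hδ, hball⟩ := exists_ball_subset_chart (n := n) p hr
  set x₀ := extChartAt (𝓡 n) p p
  set G := chartMetric n p
  have hG := isMetricOn_chartMetric (n := n) p
  refine ⟨δ, hδ, fun q hqp hq => ?_⟩
  set y := extChartAt (𝓡 n) p q
  have hyB := (hball q hq).2
  have hinj : ∀ q₁ q₂, dist p q₁ < δ → dist p q₂ < δ →
      extChartAt (𝓡 n) p q₁ = extChartAt (𝓡 n) p q₂ → q₁ = q₂ := fun q₁ q₂ h₁ h₂ h =>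
    (extChartAt (𝓡 n) p).injOn (by simpa using (hball q₁ h₁).1) (by simpa using (hball q₂ h₂).1) h
  have hF0 : ∀ y, 0 ≤ G x₀ (R y) (R y) := fun y => hG.nonneg (mem_extChartAt_target p) _
  have hRy : R y ≠ 0 := fun h => hqp (hinj q p hq (by simpa using hδ) (hRne y hyB h))
  have hFpos : 0 < G x₀ (R y) (R y) := hG.pos _ (mem_extChartAt_target p) _ hRy
  set ℓ := √(G x₀ (R y) (R y)) with hℓ
  have hℓpos : 0 < ℓ := Real.sqrt_pos.2 hFpos
  have hℓ2 : ℓ ^ 2 = G x₀ (R y) (R y) := Real.sq_sqrt hFpos.le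
  -- A path from p of length less than δ cannot leave the coordinate ball, so the eikonal inequality
  -- applies along all of it.
  have hle : ℓ ≤ dist p q := by
    refine le_of_forall_gt_imp_ge_of_dense fun a ha => ?_
    obtain ⟨σ, hσ, hσ0, hσ1, hσl⟩ := exists_path_of_dist_lt (n := n) (lt_min ha hq)
    have := sqrt_le_of_eikonal hσ (p := p) (F := fun y => G x₀ (R y) (R y))
      (B := Metric.ball x₀ r) (fun y _ => hF0 y) hRd (fun t ht => by
        refine hball _ ?_
        have h1 := dist_le_integral_speed hσ ht.1
        have h2 := integral_speed_add hσ (a := 0) (b := t) (c := 1)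
        have h3 : 0 ≤ ∫ s in t..1, ‖(velocity n σ s).2‖ :=
          intervalIntegral.integral_nonneg ht.2 fun s _ => norm_nonneg _
        rw [hσ0] at h1
        have := hσl.trans_le (min_le_right _ _)
        linarith) (by
        rw [hσ0]
        change G x₀ (R x₀) (R x₀) = 0
        rw [hR0]; simp)
    rw [hσ1] at this
    exact this.trans (hσl.le.trans (min_le_left _ _))
  -- The direction depends on q alone. Hence it serves any geodesic that passes p with this
  -- velocity, at any time t₀, and not only one that starts there.
  refine ⟨(ℓ⁻¹ • R y : EuclideanSpace ℝ (Fin n)), ?_, fun γ t₀ hγ hγ0 => ?_⟩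
  · have h1 : _ = G x₀ (ℓ⁻¹ • R y) (ℓ⁻¹ • R y) := norm_sq_eq_chartMetric_self (n := n) p
      (ℓ⁻¹ • R y : EuclideanSpace ℝ (Fin n))
    simp only [map_smul, smul_apply, smul_eq_mul] at h1
    rw [← hℓ2] at h1
    have h2 : ℓ⁻¹ * (ℓ⁻¹ * ℓ ^ 2) = 1 := by field_simp
    rw [h2] at h1
    exact (pow_eq_one_iff_of_nonneg (norm_nonneg _) two_ne_zero).1 h1
  have hγt₀ : γ t₀ = p := congrArg TotalSpace.proj hγ0
  have hdist : ∀ t, dist p (γ (t₀ + t)) ≤ |t| := fun t => by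
    have := hγ.dist_le t₀ (t₀ + t)
    rw [hγt₀] at this
    simpa using this
  have hend : γ (t₀ + ℓ) = q := by
    have hδℓ : dist p (γ (t₀ + ℓ)) < δ :=
      (hdist ℓ).trans_lt (by rw [abs_of_pos hℓpos]; exact hle.trans_lt hq)
    refine hinj _ _ hδℓ hq ?_
    refine hRg y hyB ℓ hℓpos hℓ2 (fun t => extChartAt (𝓡 n) p (γ (t₀ + t)))
      (fun t => tangentCoord p (velocity n γ (t₀ + t))) ?_ ?_ fun t ht => ?_
    · simp [hγt₀, x₀]
    · simp only [add_zero, hγ0]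
      exact tangentCoord_self p _
    · have h1 : dist p (γ (t₀ + t)) < δ :=
        (hdist t).trans_lt (by rw [abs_of_nonneg ht.1]; exact (ht.2.trans hle).trans_lt hq)
      obtain ⟨h2, h3⟩ := hball _ h1
      obtain ⟨h4, h5, h6⟩ := hγ.hasDerivAt_chart h2
      exact ⟨h3, h4.comp_const_add t₀ t, h5.comp_const_add t₀ t, h6⟩
  have : dist p q = ℓ := le_antisymm (by
    have := hdist ℓ
    rwa [hend, abs_of_pos hℓpos] at this) hle
  rw [this, hend]

end Geodesics

/-! ### The Hopf–Rinow theorem -/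

section HopfRinow

variable {n : ℕ} {M : Type*} [MetricSpace M] [ChartedSpace (EuclideanSpace ℝ (Fin n)) M]
  [IsManifold (𝓡 n) ∞ M] [RiemannianBundle (fun x : M => TangentSpace (𝓡 n) x)]

theorem speed_sq_extChartAt_symm_comp {p : M} {c : ℝ → EuclideanSpace ℝ (Fin n)}
    {c' : EuclideanSpace ℝ (Fin n)} {t : ℝ} (hc : HasDerivAt c c' t)
    (ht : c t ∈ (extChartAt (𝓡 n) p).target) :
    ‖(velocity n (fun s => (extChartAt (𝓡 n) p).symm (c s)) t).2‖ ^ 2 =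
      chartMetric n p (c t) c' c' := by
  have h1 : MDifferentiableAt (𝓡 n) (𝓡 n) (extChartAt (𝓡 n) p).symm (c t) :=
    ((contMDiffOn_extChartAt_symm (n := 1) p).contMDiffAt
      ((isOpen_extChartAt_target p).mem_nhds ht)).mdifferentiableAt one_ne_zero
  have h2 : MDifferentiableAt 𝓘(ℝ, ℝ) (𝓡 n) (fun s => (extChartAt (𝓡 n) p).symm (c s)) t :=
    h1.comp t hc.differentiableAt.mdifferentiableAt
  have hs := extChartAt_symm_mem ht
  have h3 := norm_sq_eq_chartMetric (p := p)
    (V := velocity n (fun s => (extChartAt (𝓡 n) p).symm (c s)) t) hs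
  have h4 := hasDerivAt_extChartAt_comp h2 hs
  have h5 : (fun s => extChartAt (𝓡 n) p ((extChartAt (𝓡 n) p).symm (c s))) =ᶠ[𝓝 t] c := by
    filter_upwards [hc.continuousAt.preimage_mem_nhds
      ((isOpen_extChartAt_target p).mem_nhds ht)] with s hs
    exact (extChartAt (𝓡 n) p).right_inv hs
  have h6 := (h4.congr_of_eventuallyEq h5.symm).unique hc
  have h7 : extChartAt (𝓡 n) p ((extChartAt (𝓡 n) p).symm (c t)) = c t :=
    (extChartAt (𝓡 n) p).right_inv ht
  rw [h3, h6]
  change chartMetric n p (extChartAt (𝓡 n) p ((extChartAt (𝓡 n) p).symm (c t))) c' c' = _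
  rw [h7]

variable [IsContMDiffRiemannianBundle (𝓡 n) ∞ (EuclideanSpace ℝ (Fin n))
      (fun x : M => TangentSpace (𝓡 n) x)] [IsRiemannianManifold (𝓡 n) M]

/-- The Riemannian distance is infinitesimally bounded by the norm of the metric in a chart. -/
theorem exists_dist_sq_le (p : M) {ε : ℝ} (hε : 0 < ε) :
    ∃ ρ > 0, ∀ y ∈ Metric.ball (extChartAt (𝓡 n) p p) ρ, ∀ z ∈ Metric.ball (extChartAt (𝓡 n) p p) ρ,
      dist ((extChartAt (𝓡 n) p).symm y) ((extChartAt (𝓡 n) p).symm z) ^ 2 ≤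
        chartMetric n p (extChartAt (𝓡 n) p p) (z - y) (z - y) + ε * ‖z - y‖ ^ 2 := by
  set x₀ := extChartAt (𝓡 n) p p
  set G := chartMetric n p
  have hG := isMetricOn_chartMetric (n := n) p
  have hx₀ := mem_extChartAt_target (I := 𝓡 n) p
  have hcont : ContinuousAt G x₀ := (hG.contDiffAt hx₀).continuousAt
  obtain ⟨ρ, hρ, hball⟩ := Metric.mem_nhds_iff.1 (Filter.inter_mem (hG.isOpen.mem_nhds hx₀)
    (hcont.preimage_mem_nhds (Metric.ball_mem_nhds _ hε)))
  refine ⟨ρ, hρ, fun y hy z hz => ?_⟩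
  set h := z - y
  -- The straight coordinate segment is a competitor for the distance.
  set c : ℝ → EuclideanSpace ℝ (Fin n) := fun t => y + t • h
  have hcB : ∀ t ∈ Icc (0 : ℝ) 1, c t ∈ Metric.ball x₀ ρ := fun t ht => by
    have := (convex_ball x₀ ρ).add_smul_sub_mem hy hz ht
    exact this
  have hc : ∀ t, HasDerivAt c h t := fun t => by
    have := ((hasDerivAt_id t).smul_const h).const_add y
    rwa [one_smul] at this
  have hbound : ∀ x ∈ Metric.ball x₀ ρ, G x h h ≤ G x₀ h h + ε * ‖h‖ ^ 2 := fun x hx => by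
    have h1 : ‖G x - G x₀‖ < ε := by simpa [dist_eq_norm] using (hball hx).2
    have h2 : (G x - G x₀) h h ≤ ‖G x - G x₀‖ * ‖h‖ * ‖h‖ :=
      (le_abs_self _).trans ((G x - G x₀).le_opNorm₂ h h)
    have h3 : (G x - G x₀) h h = G x h h - G x₀ h h := by simp
    rw [h3] at h2
    have h4 : ‖G x - G x₀‖ * ‖h‖ * ‖h‖ ≤ ε * ‖h‖ * ‖h‖ := by gcongr
    linarith [h2.trans h4, sq ‖h‖, mul_assoc ε ‖h‖ ‖h‖]
  have hK0 : 0 ≤ G x₀ h h + ε * ‖h‖ ^ 2 := by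
    have := hG.nonneg hx₀ h
    positivity
  have hsmooth : ContMDiffOn 𝓘(ℝ, ℝ) (𝓡 n) 1 (fun t => (extChartAt (𝓡 n) p).symm (c t))
      (Icc 0 1) := by
    refine (contMDiffOn_extChartAt_symm (n := 1) p).comp (t := (extChartAt (𝓡 n) p).target)
      ?_ fun t ht => (hball (hcB t ht)).1
    have : ContDiff ℝ 1 c := by fun_prop
    exact this.contMDiff.contMDiffOn
  have := dist_le_of_speed_le zero_le_one hsmooth (Real.sqrt_nonneg (G x₀ h h + ε * ‖h‖ ^ 2))
    fun t ht => by
      have ht' : t ∈ Icc (0 : ℝ) 1 := ⟨ht.1.le, ht.2.le⟩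
      refine Real.le_sqrt_of_sq_le ?_
      rw [speed_sq_extChartAt_symm_comp (hc t) (hball (hcB t ht')).1]
      exact hbound _ (hcB t ht')
  have hc0 : c 0 = y := by simp [c]
  have hc1 : c 1 = z := by simp [c, h]
  simp only [hc0, hc1, sub_zero, mul_one] at this
  calc _ ≤ √(G x₀ h h + ε * ‖h‖ ^ 2) ^ 2 := by gcongr
    _ = _ := Real.sq_sqrt hK0

/-- Two geodesics whose concatenation is minimal have no corner. -/
theorem IsGeodesic.velocity_eq_of_minimal {α β : ℝ → M} (hα : IsGeodesic n α)
    (hβ : IsGeodesic n β) {t₀ t₁ : ℝ} (hp : α t₀ = β t₁)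
    (h : ∀ᶠ s in 𝓝[>] (0 : ℝ), 2 * s ≤ dist (α (t₀ - s)) (β (t₁ + s))) :
    velocity n α t₀ = velocity n β t₁ := by
  set p := α t₀ with hpdef
  set x₀ := extChartAt (𝓡 n) p p with hx₀def
  set G := chartMetric n p
  have hG := isMetricOn_chartMetric (n := n) p
  have hx₀ := mem_extChartAt_target (I := 𝓡 n) p
  have hsα : α t₀ ∈ (chartAt (EuclideanSpace ℝ (Fin n)) p).source := mem_chart_source _ p
  have hsβ : β t₁ ∈ (chartAt (EuclideanSpace ℝ (Fin n)) p).source := hp ▸ mem_chart_source _ p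
  obtain ⟨ha1, -, ha2⟩ := hα.hasDerivAt_chart hsα
  obtain ⟨hb1, -, hb2⟩ := hβ.hasDerivAt_chart hsβ
  rw [← hp] at hb2
  set v := tangentCoord p (velocity n α t₀) with hv
  set w := tangentCoord p (velocity n β t₁) with hw
  set a : ℝ → EuclideanSpace ℝ (Fin n) := fun s => extChartAt (𝓡 n) p (α (t₀ - s))
  set b : ℝ → EuclideanSpace ℝ (Fin n) := fun s => extChartAt (𝓡 n) p (β (t₁ + s))
  have ha : HasDerivAt a (-v) 0 :=
    HasDerivAt.comp_const_sub t₀ 0 (f := fun s => extChartAt (𝓡 n) p (α s)) (by simpa using ha1)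
  have hb : HasDerivAt b w 0 :=
    HasDerivAt.comp_const_add t₁ 0 (f := fun s => extChartAt (𝓡 n) p (β s)) (by simpa using hb1)
  have ha0 : a 0 = x₀ := by simp [a, x₀, p]
  have hb0 : b 0 = x₀ := by simp [b, x₀, ← hp]
  have hslope : Filter.Tendsto (fun s : ℝ => s⁻¹ • (b s - a s)) (𝓝[>] 0) (𝓝 (w + v)) := by
    have := (hb.sub ha).tendsto_slope_zero_right
    simpa [ha0, hb0] using this
  -- To first order α(t₀ - s) and β(t₁ + s) differ by s (w + v), while their distance is at least
  -- 2s. With unit vectors v and w this leaves |w - v|² = 4 - |w + v|² ≤ 0.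
  have h4 : 4 ≤ G x₀ (w + v) (w + v) := by
    refine le_of_forall_pos_le_add fun η hη => ?_
    set ε := η / (‖w + v‖ ^ 2 + 1) with hεdef
    have hε : 0 < ε := by positivity
    obtain ⟨ρ, hρ, hdist⟩ := exists_dist_sq_le (n := n) p hε
    have hlim : Filter.Tendsto (fun s : ℝ => G x₀ (s⁻¹ • (b s - a s)) (s⁻¹ • (b s - a s)) +
        ε * ‖s⁻¹ • (b s - a s)‖ ^ 2) (𝓝[>] 0) (𝓝 (G x₀ (w + v) (w + v) + ε * ‖w + v‖ ^ 2)) := by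
      have : Continuous fun h => G x₀ h h + ε * ‖h‖ ^ 2 := by fun_prop
      exact (this.tendsto _).comp hslope
    have hle : ∀ᶠ s in 𝓝[>] (0 : ℝ), 4 ≤ G x₀ (s⁻¹ • (b s - a s)) (s⁻¹ • (b s - a s)) +
        ε * ‖s⁻¹ • (b s - a s)‖ ^ 2 := by
      have haB : ∀ᶠ s in 𝓝 (0 : ℝ), a s ∈ Metric.ball x₀ ρ :=
        ha.continuousAt.preimage_mem_nhds (by rw [ha0]; exact Metric.ball_mem_nhds _ hρ)
      have hbB : ∀ᶠ s in 𝓝 (0 : ℝ), b s ∈ Metric.ball x₀ ρ :=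
        hb.continuousAt.preimage_mem_nhds (by rw [hb0]; exact Metric.ball_mem_nhds _ hρ)
      have hαs : ∀ᶠ s in 𝓝 (0 : ℝ), α (t₀ - s) ∈ (extChartAt (𝓡 n) p).source := by
        have : ContinuousAt (fun s => α (t₀ - s)) 0 :=
          (hα.smooth.continuous.comp (continuous_const.sub continuous_id)).continuousAt
        exact this.preimage_mem_nhds (extChartAt_source_mem_nhds' (by simp [p]))
      have hβs : ∀ᶠ s in 𝓝 (0 : ℝ), β (t₁ + s) ∈ (extChartAt (𝓡 n) p).source := by
        have : ContinuousAt (fun s => β (t₁ + s)) 0 :=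
          (hβ.smooth.continuous.comp (continuous_const.add continuous_id)).continuousAt
        exact this.preimage_mem_nhds (extChartAt_source_mem_nhds' (by simp [← hp]))
      filter_upwards [h, haB.filter_mono nhdsWithin_le_nhds, hbB.filter_mono nhdsWithin_le_nhds,
        hαs.filter_mono nhdsWithin_le_nhds, hβs.filter_mono nhdsWithin_le_nhds,
        self_mem_nhdsWithin] with s hs h1 h2 h3 h5 hs0
      have hs0' : (0 : ℝ) < s := hs0
      have h6 := hdist _ h1 _ h2
      simp only [a, b] at h6
      rw [(extChartAt (𝓡 n) p).left_inv h3, (extChartAt (𝓡 n) p).left_inv h5] at h6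
      have h7 : (2 * s) ^ 2 ≤ dist (α (t₀ - s)) (β (t₁ + s)) ^ 2 := by gcongr
      have h8 : (2 * s) ^ 2 ≤ G x₀ (b s - a s) (b s - a s) + ε * ‖b s - a s‖ ^ 2 := h7.trans h6
      simp only [map_smul, smul_apply, smul_eq_mul, norm_smul, norm_inv, Real.norm_eq_abs,
        abs_of_pos hs0']
      have h9 : s⁻¹ * (s⁻¹ * G x₀ (b s - a s) (b s - a s)) + ε * (s⁻¹ * ‖b s - a s‖) ^ 2 =
        (G x₀ (b s - a s) (b s - a s) + ε * ‖b s - a s‖ ^ 2) / s ^ 2 := by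
        field_simp
      rw [h9, le_div_iff₀ (by positivity)]
      linarith
    have := ge_of_tendsto hlim hle
    refine this.trans (add_le_add le_rfl ?_)
    rw [hεdef, div_mul_eq_mul_div, div_le_iff₀ (by positivity)]
    nlinarith
  have hvw : w = v := by
    by_contra hne
    have h1 := hG.pos x₀ hx₀ (w - v) (sub_ne_zero.2 hne)
    have h2 : G x₀ v v = 1 := ha2
    have h3 : G x₀ w w = 1 := hb2
    have h5 : G x₀ v w = G x₀ w v := hG.symm _ _ _
    change 0 < G x₀ (w - v) (w - v) at h1
    simp only [map_add, map_sub, add_apply, sub_apply] at h1 h4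
    linarith
  have e1 := ofCoord_tangentCoord (V := velocity n α t₀) hsα
  have e2 := ofCoord_tangentCoord (V := velocity n β t₁) hsβ
  change ofCoord p x₀ v = _ at e1
  change ofCoord p (extChartAt (𝓡 n) p (β t₁)) w = _ at e2
  rw [← e1, ← e2, hvw, ← hp]

/-- The point q is one closest to y on the sphere of radius s about p. An almost shortest path from
p to y crosses this sphere after spending length at least s, which bounds the minimum. Here s is
small only to make the sphere compact. -/
theorem exists_dist_eq_sub (n : ℕ) {M : Type*} [MetricSpace M]
    [ChartedSpace (EuclideanSpace ℝ (Fin n)) M] [IsManifold (𝓡 n) ∞ M]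
    [RiemannianBundle (fun x : M => TangentSpace (𝓡 n) x)]
    [IsContMDiffRiemannianBundle (𝓡 n) ∞ (EuclideanSpace ℝ (Fin n))
      (fun x : M => TangentSpace (𝓡 n) x)] [IsRiemannianManifold (𝓡 n) M] (p : M) :
    ∃ δ > 0, ∀ s, 0 < s → s < δ → ∀ y, s ≤ dist p y →
    ∃ q, dist p q = s ∧ dist q y = dist p y - s := by
  have : LocallyCompactSpace M := ChartedSpace.locallyCompactSpace (EuclideanSpace ℝ (Fin n)) M
  obtain ⟨δ, hδ, hcomp⟩ := Metric.exists_isCompact_closedBall p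
  refine ⟨δ, hδ, fun s hs hsδ y hsy => ?_⟩
  have hpath : ∀ a, dist p y < a → ∃ z, dist p z = s ∧ dist z y ≤ a - s := by
    intro a ha
    obtain ⟨σ, hσ, hσ0, hσ1, hσl⟩ := exists_path_of_dist_lt (n := n) ha
    obtain ⟨t, ht, hts⟩ := intermediate_value_Icc zero_le_one
      (f := fun t => dist p (σ t)) (continuous_const.dist hσ.continuous).continuousOn
      (show s ∈ Icc (dist p (σ 0)) (dist p (σ 1)) by simp [hσ0, hσ1, hs.le, hsy])
    refine ⟨σ t, hts, ?_⟩
    have h1 := dist_le_integral_speed hσ ht.1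
    have h2 := dist_le_integral_speed hσ ht.2
    have h3 := integral_speed_add hσ (a := 0) (b := t) (c := 1)
    rw [hσ0] at h1
    rw [hσ1] at h2
    simp only at hts
    linarith
  have hS : IsCompact (Metric.sphere p s) :=
    hcomp.of_isClosed_subset Metric.isClosed_sphere
      ((Metric.sphere_subset_closedBall).trans (Metric.closedBall_subset_closedBall hsδ.le))
  have hne : (Metric.sphere p s).Nonempty := by
    obtain ⟨z, hz, -⟩ := hpath (dist p y + 1) (by linarith)
    exact ⟨z, by rw [Metric.mem_sphere']; exact hz⟩
  obtain ⟨q, hq, hmin⟩ := hS.exists_isMinOn hne (f := fun z => dist z y)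
    (continuous_id.dist continuous_const).continuousOn
  rw [Metric.mem_sphere'] at hq
  refine ⟨q, hq, le_antisymm ?_ ?_⟩
  · refine le_of_forall_pos_le_add fun ε hε => ?_
    obtain ⟨z, hz, hzy⟩ := hpath (dist p y + ε) (by linarith)
    have := hmin (a := z) (by rw [Metric.mem_sphere']; exact hz)
    simp only [mem_ofPred_eq] at this
    linarith
  · have := dist_triangle p q y
    linarith

/-- The Hopf–Rinow theorem: in a geodesically complete manifold any two distinct points are joined
by a minimal geodesic. -/
theorem exists_minimal_geodesic {Γ : UnitTangentBundle n M → ℝ → M}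
    (hΓ : ∀ v, IsGeodesic n (Γ v) ∧ velocity n (Γ v) 0 = v.1) {x y : M} (hxy : x ≠ y) :
    ∃ v : UnitTangentBundle n M, v.1.proj = x ∧ Γ v (dist x y) = y := by
  set r := dist x y with hr
  have hrpos : 0 < r := dist_pos.2 hxy
  have hstep : ∀ p : M, ∀ b > 0, b ≤ dist p y → ∃ s, 0 < s ∧ s < b ∧ ∃ q, dist p q = s ∧
      dist q y = dist p y - s ∧ ∃ w : TangentSpace (𝓡 n) p, ‖w‖ = 1 ∧ ∀ (γ : ℝ → M) (t₀ : ℝ),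
        IsGeodesic n γ → velocity n γ t₀ = ⟨p, w⟩ → γ (t₀ + s) = q := by
    intro p b hb hby
    obtain ⟨δ₁, hδ₁, h1⟩ := exists_local_direction (n := n) p
    obtain ⟨δ₂, hδ₂, h2⟩ := exists_dist_eq_sub n p
    have hm : 0 < min b (min δ₁ δ₂) := by positivity
    obtain ⟨s, hs, hsm⟩ := exists_between hm
    obtain ⟨hsb, hs12⟩ := lt_min_iff.1 hsm
    obtain ⟨hs1, hs2⟩ := lt_min_iff.1 hs12
    obtain ⟨q, hq, hqy⟩ := h2 s hs hs2 y (hsb.le.trans hby)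
    obtain ⟨w, hw, hwγ⟩ := h1 q (by rintro rfl; simp at hq; exact hs.ne hq) (hq ▸ hs1)
    exact ⟨s, hs, hsb, q, hq, hqy, w, hw, by rwa [hq] at hwγ⟩
  obtain ⟨s, hs, hsr, q, hq, hqy, w, hw, hwγ⟩ := hstep x r hrpos le_rfl
  obtain ⟨hγ, hγ0⟩ := hΓ ⟨⟨x, w⟩, hw⟩
  refine ⟨⟨⟨x, w⟩, hw⟩, rfl, ?_⟩
  set γ := Γ ⟨⟨x, w⟩, hw⟩
  have hγx : γ 0 = x := congrArg TotalSpace.proj hγ0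
  have hγc : Continuous γ := hγ.smooth.continuous
  have hγs : γ s = q := by simpa using hwγ γ 0 hγ hγ0
  -- The times up to which γ runs straight towards y. The maximal one has to be r.
  have hA : IsCompact {t ∈ Icc 0 r | dist (γ t) y = r - t} :=
    isCompact_Icc.inter_right (isClosed_eq (hγc.dist continuous_const)
      (continuous_const.sub continuous_id))
  obtain ⟨t₀, ⟨⟨ht₀, ht₀r⟩, ht₀y⟩, hmax⟩ := hA.exists_isGreatest
    ⟨s, ⟨hs.le, hsr.le⟩, by rw [hγs, hqy]⟩
  -- The first short piece makes t₀ positive, so there is room before t₀ for the corner argument.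
  have hst₀ : s ≤ t₀ := hmax ⟨⟨hs.le, hsr.le⟩, by rw [hγs, hqy]⟩
  rcases ht₀r.eq_or_lt with h | hlt
  · rw [h] at ht₀y
    simpa using ht₀y
  exfalso
  obtain ⟨u, hu, hub, q', hq', hqy', w', hw', hwγ'⟩ := hstep (γ t₀) (r - t₀) (by linarith) ht₀y.ge
  obtain ⟨hβ, hβ0⟩ := hΓ ⟨⟨γ t₀, w'⟩, hw'⟩
  set β := Γ ⟨⟨γ t₀, w'⟩, hw'⟩
  have hβp : β 0 = γ t₀ := congrArg TotalSpace.proj hβ0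
  have hβu : β u = q' := by simpa using hwγ' β 0 hβ hβ0
  -- The path from x along γ to γ t₀, then along β to q', loses no distance to y; if it could be
  -- shortened near γ t₀, then d(x, y) < r.
  have hvel : velocity n γ t₀ = velocity n β 0 := by
    refine hγ.velocity_eq_of_minimal hβ hβp.symm ?_
    filter_upwards [Ioo_mem_nhdsGT (lt_min hu (hs.trans_le hst₀))] with τ hτ
    have hτu : τ ≤ u := hτ.2.le.trans (min_le_left _ _)
    have hτt : τ ≤ t₀ := hτ.2.le.trans (min_le_right _ _)
    have h1 := hγ.dist_le 0 (t₀ - τ)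
    rw [hγx, abs_sub_comm, abs_of_nonneg (by linarith)] at h1
    have h2 := hβ.dist_le (0 + τ) u
    rw [hβu, abs_sub_comm, abs_of_nonneg (by linarith)] at h2
    have h3 := dist_triangle x (γ (t₀ - τ)) y
    have h4 := dist_triangle (γ (t₀ - τ)) (β (0 + τ)) y
    have h5 := dist_triangle (β (0 + τ)) q' y
    linarith
  have hend := hwγ' γ t₀ hγ (hvel.trans hβ0)
  have : t₀ + u ≤ t₀ := hmax ⟨⟨by linarith, by linarith⟩, by
    rw [hend, hqy', ht₀y]; ring⟩
  linarith

end HopfRinow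

/-! ### The Sasaki distance against M and against the topology of SM -/

section Sasaki

theorem abs_koszul_le {E : Type*} [NormedAddCommGroup E] [NormedSpace ℝ E]
    (D : E →L[ℝ] E →L[ℝ] E →L[ℝ] ℝ) (a b c : E) :
    |koszul D a b c| ≤ 2 * ‖D‖ * ‖a‖ * ‖b‖ * ‖c‖ := by
  have h : ∀ a b c, |D a b c| ≤ ‖D‖ * ‖a‖ * ‖b‖ * ‖c‖ := fun a b c => by
    calc |D a b c| ≤ ‖D a‖ * ‖b‖ * ‖c‖ := (D a).le_opNorm₂ b c
      _ ≤ _ := by gcongr; exact D.le_opNorm a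
  rw [koszul_apply, abs_le]
  have h1 := abs_le.1 (h a c b)
  have h2 := abs_le.1 (h b a c)
  have h3 := abs_le.1 (h c a b)
  have h4 : 0 ≤ ‖D‖ * ‖a‖ * ‖b‖ * ‖c‖ := by positivity
  have e1 : ‖D‖ * ‖a‖ * ‖c‖ * ‖b‖ = ‖D‖ * ‖a‖ * ‖b‖ * ‖c‖ := by ring
  have e2 : ‖D‖ * ‖b‖ * ‖a‖ * ‖c‖ = ‖D‖ * ‖a‖ * ‖b‖ * ‖c‖ := by ring
  have e3 : ‖D‖ * ‖c‖ * ‖a‖ * ‖b‖ = ‖D‖ * ‖a‖ * ‖b‖ * ‖c‖ := by ring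
  rw [e1] at h1
  rw [e2] at h2
  rw [e3] at h3
  constructor <;> linarith

variable {n : ℕ} {M : Type*} [MetricSpace M] [ChartedSpace (EuclideanSpace ℝ (Fin n)) M]
  [IsManifold (𝓡 n) ∞ M] [RiemannianBundle (fun x : M => TangentSpace (𝓡 n) x)]

theorem sasakiNorm_eq (v : TangentBundle (𝓡 n) M) (ξ : TangentSpace (𝓡 n).tangent v) :
    sasakiNorm v ξ = √(‖dproj v ξ‖ ^ 2 + ‖connectionMap v ξ‖ ^ 2) := by
  rw [sasakiNorm, sasakiInner, real_inner_self_eq_norm_sq, real_inner_self_eq_norm_sq]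

theorem norm_dproj_le_sasakiNorm (v : TangentBundle (𝓡 n) M) (ξ : TangentSpace (𝓡 n).tangent v) :
    ‖dproj v ξ‖ ≤ sasakiNorm v ξ := by
  rw [sasakiNorm_eq]
  exact Real.le_sqrt_of_sq_le (le_add_of_nonneg_right (by positivity))

/-- The projection of `SM` to `M` does not increase distances. -/
theorem edist_proj_le_sasakiEDist [IsRiemannianManifold (𝓡 n) M] (v w : UnitTangentBundle n M) :
    edist v.1.proj w.1.proj ≤ sasakiEDist v w := by
  refine le_iInf₂ fun c hc => ?_
  obtain ⟨hc, -, hc0, hc1⟩ := hc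
  have hπ : ContMDiffOn 𝓘(ℝ, ℝ) (𝓡 n) 1 (fun t => (c t).proj) (Icc 0 1) :=
    (contMDiff_proj (IB := 𝓡 n) (n := 1) (TangentSpace (𝓡 n) : M → Type _)).comp_contMDiffOn hc
  rw [IsRiemannianManifold.out (I := 𝓡 n)]
  refine (riemannianEDist_le_pathELength hπ (by rw [hc0]) (by rw [hc1]) zero_le_one).trans ?_
  -- The curve is C¹ only on [0, 1], so its derivative is under control only at interior times; the
  -- endpoints have measure zero.
  rw [pathELength_eq_lintegral_mfderiv_Ioo, sasakiLength, ← restrict_Ioo_eq_restrict_Icc]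
  refine lintegral_mono_ae ((ae_restrict_iff' measurableSet_Ioo).2
    (Filter.Eventually.of_forall fun t ht => ?_))
  have hct : MDifferentiableAt 𝓘(ℝ, ℝ) (𝓡 n).tangent c t :=
    (hc.contMDiffAt (Icc_mem_nhds ht.1 ht.2)).mdifferentiableAt one_ne_zero
  rw [← ofReal_norm]
  refine ENNReal.ofReal_le_ofReal (le_trans (le_of_eq ?_) (norm_dproj_le_sasakiNorm _ _))
  exact (congrArg norm (dproj_mfderiv hct)).symm

variable [IsContMDiffRiemannianBundle (𝓡 n) ∞ (EuclideanSpace ℝ (Fin n))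
      (fun x : M => TangentSpace (𝓡 n) x)]

/-- The Sasaki norm is bounded, locally uniformly, by the coordinate expressions of a curve. -/
theorem exists_sasakiNorm_le (p : M) : ∃ A ≥ 0, ∀ᶠ x in 𝓝 (extChartAt (𝓡 n) p p),
    ∀ (V : ℝ → TangentBundle (𝓡 n) M) (t : ℝ) (y' u' : EuclideanSpace ℝ (Fin n)),
      (V t).proj ∈ (chartAt (EuclideanSpace ℝ (Fin n)) p).source →
      extChartAt (𝓡 n) p (V t).proj = x →
      MDifferentiableAt 𝓘(ℝ, ℝ) (𝓡 n).tangent V t →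
      HasDerivAt (fun s => extChartAt (𝓡 n) p (V s).proj) y' t →
      HasDerivAt (fun s => tangentCoord p (V s)) u' t →
      sasakiNorm (V t) (mfderiv 𝓘(ℝ, ℝ) (𝓡 n).tangent V t (1 : ℝ)) ≤
        A * (‖y'‖ * (1 + ‖tangentCoord p (V t)‖) + ‖u'‖) := by
  set x₀ := extChartAt (𝓡 n) p p
  set G := chartMetric n p with hGdef
  have hG := isMetricOn_chartMetric (n := n) p
  have hx₀ := mem_extChartAt_target (I := 𝓡 n) p
  obtain ⟨m, hm, hmG⟩ := hG.exists_lower_bound hx₀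
  set C₁ := ‖G x₀‖ + 1
  set C₂ := ‖fderiv ℝ G x₀‖ + 1
  have hC₁0 : 0 < C₁ := by positivity
  have hC₂0 : 0 < C₂ := by positivity
  have hC₁ : ∀ᶠ x in 𝓝 x₀, ‖G x‖ < C₁ :=
    (hG.contDiffAt hx₀).continuousAt.norm.eventually_lt_const (lt_add_one _)
  have hC₂ : ∀ᶠ x in 𝓝 x₀, ‖fderiv ℝ G x‖ < C₂ :=
    (hG.contDiffAt_fderiv hx₀).continuousAt.norm.eventually_lt_const (lt_add_one _)
  refine ⟨√C₁ * (1 + (C₁ + 2 * C₂) / m), by positivity, ?_⟩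
  filter_upwards [hmG, hC₁, hC₂] with x hmx h1 h2 V t y' u' hp hx hV hy hu
  obtain ⟨y'', u'', hy'', hu'', hd, hK⟩ := connectionMap_coord hV hp
  obtain rfl := hy''.unique hy
  obtain rfl := hu''.unique hu
  set U := tangentCoord p (V t)
  set ξ := mfderiv 𝓘(ℝ, ℝ) (𝓡 n).tangent V t (1 : ℝ)
  set k := tangentCoord p ⟨(V t).proj, connectionMap (V t) ξ⟩
  have hd2 : ‖dproj (V t) ξ‖ ^ 2 = G x y'' y'' := by
    have := norm_sq_eq_chartMetric (p := p) (V := ⟨(V t).proj, dproj (V t) ξ⟩) hp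
    rw [hd] at this
    rw [← hx]
    exact this
  have hk2 : ‖connectionMap (V t) ξ‖ ^ 2 = G x k k := by
    have := norm_sq_eq_chartMetric (p := p) (V := ⟨(V t).proj, connectionMap (V t) ξ⟩) hp
    rw [← hx]
    exact this
  have hGle : ∀ a b, G x a b ≤ C₁ * ‖a‖ * ‖b‖ := fun a b => by
    calc G x a b ≤ ‖G x‖ * ‖a‖ * ‖b‖ := (le_abs_self _).trans ((G x).le_opNorm₂ a b)
      _ ≤ _ := by gcongr
  -- The defining relation of the covariant derivative, tested against k itself, bounds k without
  -- inverting the metric.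
  have hk : m * ‖k‖ ≤ C₁ * ‖u''‖ + 2 * C₂ * ‖y''‖ * ‖U‖ := by
    rcases (norm_nonneg k).eq_or_lt with h0 | h0
    · rw [← h0]; simp only [mul_zero]; positivity
    · refine le_of_mul_le_mul_right ?_ h0
      have h3 : G x k k = G x u'' k + koszul (fderiv ℝ G x) y'' U k := by
        rw [← hx]
        exact hK k
      have h4 : koszul (fderiv ℝ G x) y'' U k ≤ 2 * C₂ * ‖y''‖ * ‖U‖ * ‖k‖ := by
        calc _ ≤ 2 * ‖fderiv ℝ G x‖ * ‖y''‖ * ‖U‖ * ‖k‖ :=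
              (le_abs_self _).trans (abs_koszul_le _ _ _ _)
          _ ≤ _ := by gcongr
      calc m * ‖k‖ * ‖k‖ = m * ‖k‖ ^ 2 := by ring
        _ ≤ G x k k := hmx k
        _ ≤ C₁ * ‖u''‖ * ‖k‖ + 2 * C₂ * ‖y''‖ * ‖U‖ * ‖k‖ := by
          rw [h3]; exact add_le_add (hGle _ _) h4
        _ = _ := by ring
  have hk' : ‖k‖ ≤ (C₁ + 2 * C₂) / m * (‖y''‖ * ‖U‖ + ‖u''‖) := by
    rw [div_mul_eq_mul_div, le_div_iff₀ hm, mul_comm]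
    refine hk.trans ?_
    have : 0 ≤ C₁ * (‖y''‖ * ‖U‖) := by positivity
    have : 0 ≤ C₂ * ‖u''‖ := by positivity
    linarith
  rw [sasakiNorm_eq, hd2, hk2]
  calc √(G x y'' y'' + G x k k) ≤ √(C₁ * (‖y''‖ + ‖k‖) ^ 2) := by
        refine Real.sqrt_le_sqrt ?_
        have h5 : 0 ≤ C₁ * ‖y''‖ * ‖k‖ := by positivity
        calc _ ≤ C₁ * ‖y''‖ * ‖y''‖ + C₁ * ‖k‖ * ‖k‖ := add_le_add (hGle _ _) (hGle _ _)
          _ ≤ _ := by linarith [h5]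
    _ = √C₁ * (‖y''‖ + ‖k‖) := by
        rw [Real.sqrt_mul hC₁0.le, Real.sqrt_sq (by positivity)]
    _ ≤ √C₁ * ((1 + (C₁ + 2 * C₂) / m) * (‖y''‖ * (1 + ‖U‖) + ‖u''‖)) := by
        gcongr
        have h6 : 0 ≤ ‖y''‖ * ‖U‖ := by positivity
        have h7 : 0 ≤ (C₁ + 2 * C₂) / m * ‖y''‖ := by positivity
        have h8 := norm_nonneg u''
        linarith
    _ = _ := by ring

/-- The topology of `SM` is finer than the topology of the Sasaki distance. -/
theorem eventually_sasakiEDist_lt (v : UnitTangentBundle n M) {δ : ℝ≥0∞} (hδ : 0 < δ) :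
    ∀ᶠ w in 𝓝 v, sasakiEDist v w < δ := by
  set p := v.1.proj with hpdef
  set x₀ := extChartAt (𝓡 n) p p with hx₀def
  set u₀ := tangentCoord p v.1
  set G := chartMetric n p with hGdef
  have hG := isMetricOn_chartMetric (n := n) p
  have hx₀ := mem_extChartAt_target (I := 𝓡 n) p
  obtain ⟨A, hA0, hA⟩ := exists_sasakiNorm_le (n := n) p
  set N : EuclideanSpace ℝ (Fin n) × EuclideanSpace ℝ (Fin n) → ℝ := fun z => G z.1 z.2 z.2
  -- Fibrewise normalisation. It fixes unit vectors and pushes the coordinate segment from v to w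
  -- into SM without moving its endpoints.
  set S : EuclideanSpace ℝ (Fin n) × EuclideanSpace ℝ (Fin n) → EuclideanSpace ℝ (Fin n) :=
    fun z => (√(N z))⁻¹ • z.2
  have hunit : ∀ w : UnitTangentBundle n M,
      w.1.proj ∈ (chartAt (EuclideanSpace ℝ (Fin n)) p).source →
      N (extChartAt (𝓡 n) p w.1.proj, tangentCoord p w.1) = 1 := fun w hw => by
    have := norm_sq_eq_chartMetric hw
    rw [w.2, one_pow] at this
    exact this.symm
  have hpp : p ∈ (chartAt (EuclideanSpace ℝ (Fin n)) p).source := mem_chart_source _ p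
  have hN₀ : N (x₀, u₀) = 1 := hunit v hpp
  have hNd : ∀ z : EuclideanSpace ℝ (Fin n) × EuclideanSpace ℝ (Fin n),
      z.1 ∈ (extChartAt (𝓡 n) p).target → ContDiffAt ℝ ∞ N z := fun z hz => by
    have h1 : ContDiffAt ℝ ∞ (fun z : EuclideanSpace ℝ (Fin n) × EuclideanSpace ℝ (Fin n) => G z.1)
      z := (hG.contDiffAt hz).comp z contDiffAt_fst
    exact (h1.clm_apply contDiffAt_snd).clm_apply contDiffAt_snd
  have hSd : ∀ z : EuclideanSpace ℝ (Fin n) × EuclideanSpace ℝ (Fin n),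
      z.1 ∈ (extChartAt (𝓡 n) p).target → 0 < N z → ContDiffAt ℝ ∞ S z := fun z hz hNz =>
    (((hNd z hz).sqrt hNz.ne').inv (Real.sqrt_pos.2 hNz).ne').smul contDiffAt_snd
  have hSd₀ := hSd (x₀, u₀) hx₀ (by rw [hN₀]; exact one_pos)
  set L := ‖fderiv ℝ S (x₀, u₀)‖ + 1
  have hL : ∀ᶠ z in 𝓝 (x₀, u₀), ‖fderiv ℝ S z‖ < L :=
    ((hSd₀.fderiv_right (m := 0) (by simp)).continuousAt.norm).eventually_lt_const (lt_add_one _)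
  have hNpos : ∀ᶠ z in 𝓝 (x₀, u₀), 0 < N z :=
    (hNd (x₀, u₀) hx₀).continuousAt.eventually_const_lt (by rw [hN₀]; exact one_pos)
  have hS1 : ∀ᶠ z in 𝓝 (x₀, u₀), ‖S z‖ < ‖S (x₀, u₀)‖ + 1 :=
    hSd₀.continuousAt.norm.eventually_lt_const (lt_add_one _)
  have htg : ∀ᶠ z in 𝓝 (x₀, u₀), z.1 ∈ (extChartAt (𝓡 n) p).target :=
    continuousAt_fst.preimage_mem_nhds (hG.isOpen.mem_nhds hx₀)
  have hA' := (continuousAt_fst (p := (x₀, u₀))).eventually hA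
  obtain ⟨ρ, hρ, hball⟩ := Metric.mem_nhds_iff.1
    (hL.and (hNpos.and (hS1.and (htg.and hA'))))
  -- Near (x₀, u₀) one has ‖S‖ < ‖S (x₀, u₀)‖ + 1 and ‖DS‖ < L, so the speed of the normalised
  -- segment is at most B ‖h‖.
  set B := A * (2 + ‖S (x₀, u₀)‖ + L) with hB
  have hB0 : 0 ≤ B := by positivity
  set Z : UnitTangentBundle n M → EuclideanSpace ℝ (Fin n) × EuclideanSpace ℝ (Fin n) :=
    fun w => (extChartAt (𝓡 n) p w.1.proj, tangentCoord p w.1)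
  have hZv : Z v = (x₀, u₀) := rfl
  have hZ : ContinuousAt Z v := by
    have h1 : ContinuousAt (extChartAt (𝓡 n).tangent v.1) v.1 := continuousAt_extChartAt v.1
    exact ContinuousAt.comp (f := Subtype.val) (g := extChartAt (𝓡 n).tangent v.1) h1
      continuousAt_subtype_val
  have hπ : ContinuousAt (fun w : UnitTangentBundle n M => w.1.proj) v :=
    ((FiberBundle.continuous_proj (EuclideanSpace ℝ (Fin n))
      (TangentSpace (𝓡 n) : M → Type _)).comp continuous_subtype_val).continuousAt
  have hlen : ∀ᶠ w in 𝓝 v, ENNReal.ofReal (B * ‖Z w - Z v‖) < δ := by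
    have h1 : ContinuousAt (fun w => ENNReal.ofReal (B * ‖Z w - Z v‖)) v :=
      ENNReal.continuous_ofReal.continuousAt.comp
        (continuousAt_const.mul (hZ.sub continuousAt_const).norm)
    refine h1.eventually_lt_const ?_
    simpa using hδ
  filter_upwards [hlen, hZ.preimage_mem_nhds (Metric.ball_mem_nhds _ hρ),
    hπ.preimage_mem_nhds (chart_source_mem_nhds (EuclideanSpace ℝ (Fin n)) p)] with w hw hwB hwp
  refine lt_of_le_of_lt ?_ hw
  set h := Z w - Z v
  set z : ℝ → EuclideanSpace ℝ (Fin n) × EuclideanSpace ℝ (Fin n) := fun t => Z v + t • h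
  have hzd : ∀ t, HasDerivAt z h t := fun t => by
    have := ((hasDerivAt_id t).smul_const h).const_add (Z v)
    rwa [one_smul] at this
  have hz0 : z 0 = Z v := by simp [z]
  have hz1 : z 1 = Z w := by simp [z, h]
  have hzB : ∀ t ∈ Icc (0 : ℝ) 1, z t ∈ Metric.ball (x₀, u₀) ρ := fun t ht =>
    (convex_ball (x₀, u₀) ρ).add_smul_sub_mem (Metric.mem_ball_self hρ) hwB ht
  set c : ℝ → TangentBundle (𝓡 n) M := fun t => ofCoord p (z t).1 (S (z t))
  have hc1 : ∀ t ∈ Icc (0 : ℝ) 1, ∀ᶠ s in 𝓝 t, (z s).1 ∈ (extChartAt (𝓡 n) p).target ∧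
      0 < N (z s) := fun t ht => by
    filter_upwards [(hzd t).continuousAt.preimage_mem_nhds
      (Metric.isOpen_ball.mem_nhds (hzB t ht))] with s hs
    exact ⟨(hball hs).2.2.2.1, (hball hs).2.1⟩
  have hcd : ∀ t ∈ Icc (0 : ℝ) 1, ContMDiffAt 𝓘(ℝ, ℝ) (𝓡 n).tangent 1 c t := by
    intro t ht
    have hs : ∀ s, (z s).1 ∈ (extChartAt (𝓡 n) p).target →
        c s ∈ (trivializationAt (EuclideanSpace ℝ (Fin n)) (TangentSpace (𝓡 n)) p).source :=
      fun s hs => (Trivialization.mem_source _).2 (extChartAt_symm_mem hs)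
    have hzc : ContMDiffAt 𝓘(ℝ, ℝ) 𝓘(ℝ, EuclideanSpace ℝ (Fin n)) 1 (fun s => (z s).1) t := by
      have : ContDiff ℝ 1 fun s => (z s).1 := by fun_prop
      exact this.contMDiff.contMDiffAt
    have hSz : ContMDiffAt 𝓘(ℝ, ℝ) 𝓘(ℝ, EuclideanSpace ℝ (Fin n)) 1 (fun s => S (z s)) t := by
      have h1 : ContDiffAt ℝ 1 z t := by fun_prop
      have h2 := (hball (hzB t ht)).2
      exact (((hSd (z t) h2.2.2.1 h2.1).of_le (by simp)).comp t h1).contMDiffAt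
    refine (Trivialization.contMDiffAt_iff (IB := 𝓡 n)
      (e := trivializationAt (EuclideanSpace ℝ (Fin n)) (TangentSpace (𝓡 n)) p)
      (hs t (hc1 t ht).self_of_nhds.1)).2 ⟨?_, ?_⟩
    · exact ContMDiffAt.comp (g := (extChartAt (𝓡 n) p).symm) (f := fun s => (z s).1) t
        ((contMDiffOn_extChartAt_symm (n := 1) p).contMDiffAt
          (hG.isOpen.mem_nhds (hc1 t ht).self_of_nhds.1)) hzc
    · refine hSz.congr_of_eventuallyEq ?_
      filter_upwards [hc1 t ht] with s hs
      exact tangentCoord_ofCoord hs.1 _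
  have hSc : ∀ t, (z t).1 ∈ (extChartAt (𝓡 n) p).target → tangentCoord p (c t) = S (z t) ∧
      extChartAt (𝓡 n) p (c t).proj = (z t).1 := fun t ht =>
    ⟨tangentCoord_ofCoord ht _, (extChartAt (𝓡 n) p).right_inv ht⟩
  have hend : ∀ w' : UnitTangentBundle n M, w'.1.proj ∈
      (chartAt (EuclideanSpace ℝ (Fin n)) p).source →
      ofCoord p (Z w').1 (S (Z w')) = w'.1 := fun w' hw' => by
    have h1 : S (Z w') = tangentCoord p w'.1 := by
      simp only [S, Z, hunit w' hw']
      simp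
    rw [h1]
    exact ofCoord_tangentCoord hw'
  refine (iInf₂_le c ⟨fun t ht => (hcd t ht).contMDiffWithinAt, fun t ht => ?_, ?_, ?_⟩).trans ?_
  · rw [sasakiLength]
    calc _ ≤ ∫⁻ t in Icc (0 : ℝ) 1, ENNReal.ofReal (B * ‖h‖) := by
          refine setLIntegral_mono measurable_const fun t ht => ENNReal.ofReal_le_ofReal ?_
          obtain ⟨b1, b2, b3, b4, b5⟩ := hball (hzB t ht)
          obtain ⟨h3, h4⟩ := hSc t b4
          have hev1 : (fun s => extChartAt (𝓡 n) p (c s).proj) =ᶠ[𝓝 t] fun s => (z s).1 :=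
            (hc1 t ht).mono fun s hs => (hSc s hs.1).2
          have hev2 : (fun s => tangentCoord p (c s)) =ᶠ[𝓝 t] fun s => S (z s) :=
            (hc1 t ht).mono fun s hs => (hSc s hs.1).1
          have hy : HasDerivAt (fun s => extChartAt (𝓡 n) p (c s).proj) h.1 t :=
            ((ContinuousLinearMap.fst ℝ (EuclideanSpace ℝ (Fin n))
              (EuclideanSpace ℝ (Fin n))).hasFDerivAt.comp_hasDerivAt t
                (hzd t)).congr_of_eventuallyEq hev1
          have hu : HasDerivAt (fun s => tangentCoord p (c s)) (fderiv ℝ S (z t) h) t :=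
            (((hSd (z t) b4 b2).differentiableAt (by simp)).hasFDerivAt.comp_hasDerivAt t
                (hzd t)).congr_of_eventuallyEq hev2
          refine (b5 c t _ _ (extChartAt_symm_mem b4) h4
            ((hcd t ht).mdifferentiableAt one_ne_zero) hy hu).trans ?_
          rw [h3, hB, mul_assoc]
          gcongr
          have g1 : ‖h.1‖ ≤ ‖h‖ := norm_fst_le h
          have g2 : ‖fderiv ℝ S (z t) h‖ ≤ L * ‖h‖ :=
            ((fderiv ℝ S (z t)).le_opNorm h).trans (by gcongr)
          have g3 : ‖h.1‖ * (1 + ‖S (z t)‖) ≤ ‖h‖ * (1 + (‖S (x₀, u₀)‖ + 1)) := by gcongr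
          linarith
      _ = ENNReal.ofReal (B * ‖h‖) := by simp
  · have h1 := (hball (hzB t ht)).2.2.2.1
    have h2 := norm_sq_eq_chartMetric (V := c t) (p := p) (extChartAt_symm_mem h1)
    obtain ⟨h3, h4⟩ := hSc t h1
    rw [h3, h4] at h2
    have h5 : chartMetric n p (z t).1 (S (z t)) (S (z t)) = 1 := by
      have h6 : 0 < N (z t) := (hball (hzB t ht)).2.1
      have h7 := Real.sq_sqrt h6.le
      have h8 := Real.sqrt_pos.2 h6
      simp only [S, map_smul, smul_apply, smul_eq_mul]
      change (√(N (z t)))⁻¹ * ((√(N (z t)))⁻¹ * N (z t)) = 1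
      nth_rewrite 3 [← h7]
      field_simp
    rw [h5] at h2
    exact (pow_eq_one_iff_of_nonneg (norm_nonneg _) two_ne_zero).1 h2
  · simp only [c, hz0]
    exact hend v hpp
  · simp only [c, hz1]
    exact hend w hwp

end Sasaki

/-! ### Bounded orbits and the diameter of spheres -/

section Spheres

/-- A locally bounded pseudodistance on a compact connected space is bounded. -/
theorem exists_le_of_eventually_le {X : Type*} [TopologicalSpace X] [CompactSpace X]
    [PreconnectedSpace X] (D : X → X → ℝ≥0∞) (hself : ∀ v, D v v = 0)
    (hsymm : ∀ v w, D v w = D w v) (htri : ∀ u v w, D u w ≤ D u v + D v w)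
    (hloc : ∀ v, ∀ᶠ w in 𝓝 v, D v w ≤ 1) : ∃ C < ⊤, ∀ v w, D v w ≤ C := by
  rcases isEmpty_or_nonempty X with hX | ⟨⟨v₀⟩⟩
  · exact ⟨0, by simp, fun v => hX.elim v⟩
  -- Connectedness makes D v₀ finite everywhere; compactness then makes it bounded, and the triangle
  -- inequality through v₀ doubles the bound.
  have hclopen : IsClopen {w | D v₀ w < ⊤} := by
    constructor
    · rw [← isOpen_compl_iff, isOpen_iff_mem_nhds]
      intro w hw
      filter_upwards [hloc w] with w' hw' h
      refine hw ((htri v₀ w' w).trans_lt (ENNReal.add_lt_top.2 ⟨h, ?_⟩))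
      rw [hsymm]
      exact hw'.trans_lt ENNReal.one_lt_top
    · rw [isOpen_iff_mem_nhds]
      intro w hw
      filter_upwards [hloc w] with w' hw'
      exact (htri v₀ w w').trans_lt (ENNReal.add_lt_top.2 ⟨hw, hw'.trans_lt ENNReal.one_lt_top⟩)
  have hfin : ∀ w, D v₀ w < ⊤ := fun w =>
    isPreconnected_univ.subset_isClopen hclopen ⟨v₀, trivial, by simp [hself]⟩ (mem_univ w)
  obtain ⟨C, hC, hle⟩ : ∃ C < ⊤, ∀ w ∈ (univ : Set X), D v₀ w ≤ C := by
    refine isCompact_univ.induction_on (p := fun s => ∃ C < ⊤, ∀ w ∈ s, D v₀ w ≤ C)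
      ⟨0, by simp, by simp⟩ ?_ ?_ ?_
    · rintro s t hst ⟨C, hC, h⟩
      exact ⟨C, hC, fun w hw => h w (hst hw)⟩
    · rintro s t ⟨C, hC, h⟩ ⟨C', hC', h'⟩
      refine ⟨max C C', max_lt hC hC', ?_⟩
      rintro w (hw | hw)
      · exact (h w hw).trans (le_max_left _ _)
      · exact (h' w hw).trans (le_max_right _ _)
    · intro w _
      refine ⟨{w' | D w w' ≤ 1}, mem_nhdsWithin_of_mem_nhds (hloc w), D v₀ w + 1,
        ENNReal.add_lt_top.2 ⟨hfin w, ENNReal.one_lt_top⟩, fun w' hw' => ?_⟩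
      exact (htri v₀ w w').trans (add_le_add le_rfl hw')
  refine ⟨C + C, ENNReal.add_lt_top.2 ⟨hC, hC⟩, fun v w => (htri v v₀ w).trans ?_⟩
  rw [hsymm v v₀]
  exact add_le_add (hle v trivial) (hle w trivial)

variable {n : ℕ} {M : Type*} [MetricSpace M] [ChartedSpace (EuclideanSpace ℝ (Fin n)) M]
  [IsManifold (𝓡 n) ∞ M]

theorem continuousOn_ofCoord (p : M) :
    ContinuousOn (fun z : EuclideanSpace ℝ (Fin n) × EuclideanSpace ℝ (Fin n) =>
      ofCoord p z.1 z.2) ((extChartAt (𝓡 n) p).target ×ˢ univ) := by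
  set e := trivializationAt (EuclideanSpace ℝ (Fin n)) (TangentSpace (𝓡 n) : M → Type _) p
  have h1 : ContinuousOn (fun z : EuclideanSpace ℝ (Fin n) × EuclideanSpace ℝ (Fin n) =>
      ((extChartAt (𝓡 n) p).symm z.1, z.2)) ((extChartAt (𝓡 n) p).target ×ˢ univ) :=
    ((continuousOn_extChartAt_symm p).comp continuousOn_fst fun z hz => hz.1).prodMk
      continuousOn_snd
  have h2 := e.toOpenPartialHomeomorph.continuousOn_symm.comp h1 fun z hz =>
    e.mem_target.2 (extChartAt_symm_mem hz.1)
  refine h2.congr fun z hz => ?_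
  have hb : (extChartAt (𝓡 n) p).symm z.1 ∈ e.baseSet := extChartAt_symm_mem hz.1
  simp only [ofCoord, Function.comp]
  rw [← e.mk_symm hb, Trivialization.symmL_apply]
  exact hb

variable [RiemannianBundle (fun x : M => TangentSpace (𝓡 n) x)]
  [IsContMDiffRiemannianBundle (𝓡 n) ∞ (EuclideanSpace ℝ (Fin n))
      (fun x : M => TangentSpace (𝓡 n) x)]

/-- The unit tangent vectors at the points of a small coordinate ball form a continuous image of the
product of a closed ball and a sphere. -/
theorem exists_unit_parametrization (p : M) : ∃ ρ > 0,
    ∃ ψ : Metric.closedBall (extChartAt (𝓡 n) p p) ρ ×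
      Metric.sphere (0 : EuclideanSpace ℝ (Fin n)) 1 → UnitTangentBundle n M,
      Continuous ψ ∧ ∀ᶠ x in 𝓝 p, ∀ v : UnitTangentBundle n M, v.1.proj = x → v ∈ range ψ := by
  set x₀ := extChartAt (𝓡 n) p p
  set G := chartMetric n p
  have hG := isMetricOn_chartMetric (n := n) p
  have hx₀ := mem_extChartAt_target (I := 𝓡 n) p
  obtain ⟨ρ, hρ, hball⟩ := Metric.nhds_basis_closedBall.mem_iff.1 (hG.isOpen.mem_nhds hx₀)
  have hGpos : ∀ z : Metric.closedBall x₀ ρ × Metric.sphere (0 : EuclideanSpace ℝ (Fin n)) 1,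
      0 < G z.1 z.2 z.2 := fun z => hG.pos _ (hball z.1.2) _ (ne_zero_of_mem_unit_sphere z.2)
  have hunit : ∀ z : Metric.closedBall x₀ ρ × Metric.sphere (0 : EuclideanSpace ℝ (Fin n)) 1,
      ‖(ofCoord p (z.1 : EuclideanSpace ℝ (Fin n)) ((√(G z.1 z.2 z.2))⁻¹ • z.2.1)).2‖ = 1 := by
    intro z
    have h1 := Real.sqrt_pos.2 (hGpos z)
    have h2 := Real.sq_sqrt (hGpos z).le
    rw [← pow_eq_one_iff_of_nonneg (norm_nonneg _) two_ne_zero, ← chartMetric_self]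
    simp only [map_smul, smul_apply, smul_eq_mul]
    change (√(G z.1 z.2 z.2))⁻¹ * ((√(G z.1 z.2 z.2))⁻¹ * G z.1 z.2 z.2) = 1
    nth_rewrite 3 [← h2]
    field_simp
  -- A Euclidean unit vector is rescaled to unit Riemannian length, so the fibres are parametrised
  -- by one fixed sphere.
  refine ⟨ρ, hρ, fun z => ⟨_, hunit z⟩, ?_, ?_⟩
  · refine Continuous.subtype_mk ?_ _
    have hGc : Continuous fun z : Metric.closedBall x₀ ρ ×
        Metric.sphere (0 : EuclideanSpace ℝ (Fin n)) 1 => G z.1 := by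
      have h1 : ContinuousOn G (Metric.closedBall x₀ ρ) := hG.contDiffOn.continuousOn.mono hball
      exact h1.domRestrict.comp continuous_fst
    have hz : Continuous fun z : Metric.closedBall x₀ ρ ×
        Metric.sphere (0 : EuclideanSpace ℝ (Fin n)) 1 => (z.2 : EuclideanSpace ℝ (Fin n)) :=
      continuous_subtype_val.comp continuous_snd
    have hN := ((hGc.clm_apply hz).clm_apply hz).sqrt.inv₀
      fun z => (Real.sqrt_pos.2 (hGpos z)).ne'
    have h2 : Continuous fun z : Metric.closedBall x₀ ρ ×
        Metric.sphere (0 : EuclideanSpace ℝ (Fin n)) 1 =>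
        ((z.1 : EuclideanSpace ℝ (Fin n)),
          (√(G z.1 z.2 z.2))⁻¹ • (z.2 : EuclideanSpace ℝ (Fin n))) :=
      (continuous_subtype_val.comp continuous_fst).prodMk (hN.smul hz)
    exact (continuousOn_ofCoord p).comp_continuous h2 fun z => ⟨hball z.1.2, trivial⟩
  · filter_upwards [chart_source_mem_nhds (EuclideanSpace ℝ (Fin n)) p,
      (continuousAt_extChartAt (I := 𝓡 n) p).preimage_mem_nhds (Metric.closedBall_mem_nhds _ hρ)]
      with x hx hxρ v hv
    subst hv
    set u := tangentCoord p v.1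
    set y := extChartAt (𝓡 n) p v.1.proj
    have hu1 : G y u u = 1 := by
      have h := norm_sq_eq_chartMetric hx
      rw [v.2, one_pow] at h
      exact h.symm
    have hu0 : u ≠ 0 := by
      intro h
      simp [h] at hu1
    have hnu : 0 < ‖u‖ := norm_pos_iff.2 hu0
    refine ⟨(⟨y, hxρ⟩, ⟨‖u‖⁻¹ • u, by simp [norm_smul, hnu.ne']⟩), Subtype.ext ?_⟩
    have h3 : (√(G y (‖u‖⁻¹ • u) (‖u‖⁻¹ • u)))⁻¹ • ‖u‖⁻¹ • u = u := by
      have h4 : G y (‖u‖⁻¹ • u) (‖u‖⁻¹ • u) = (‖u‖⁻¹) ^ 2 := by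
        simp only [map_smul, smul_apply, smul_eq_mul, hu1]
        ring
      rw [h4, Real.sqrt_sq (by positivity), inv_inv, smul_smul, mul_inv_cancel₀ hnu.ne', one_smul]
    change ofCoord p y ((√(G y (‖u‖⁻¹ • u) (‖u‖⁻¹ • u)))⁻¹ • ‖u‖⁻¹ • u) = v.1
    rw [h3]
    exact ofCoord_tangentCoord hx

variable [IsRiemannianManifold (𝓡 n) M]

/-- For a pointwise equicontinuous flow on `SM`, two orbits of vectors with nearby common foot point
stay within a locally uniformly bounded distance. -/
theorem exists_edist_flow_le (hn : 2 ≤ n) {Φ : ℝ → UnitTangentBundle n M → UnitTangentBundle n M}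
    (hequi : PointwiseEquicontinuous sasakiEDist Φ) (p : M) :
    ∃ C < ⊤, ∀ᶠ x in 𝓝 p, ∀ v w : UnitTangentBundle n M, v.1.proj = x → w.1.proj = x →
      ∀ t, edist (Φ t v).1.proj (Φ t w).1.proj ≤ C := by
  obtain ⟨ρ, hρ, ψ, hψ, hrange⟩ := exists_unit_parametrization (n := n) p
  -- The dimension hypothesis enters here: the unit sphere is connected.
  have hrank : 1 < Module.rank ℝ (EuclideanSpace ℝ (Fin n)) := by
    rw [← Module.finrank_eq_rank, finrank_euclideanSpace_fin]
    exact_mod_cast hn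
  have : PreconnectedSpace (Metric.sphere (0 : EuclideanSpace ℝ (Fin n)) 1) :=
    Subtype.preconnectedSpace (isPreconnected_sphere hrank 0 1)
  have : PreconnectedSpace (Metric.closedBall (extChartAt (𝓡 n) p p) ρ) :=
    Subtype.preconnectedSpace (convex_closedBall _ _).isPreconnected
  have : CompactSpace (Metric.closedBall (extChartAt (𝓡 n) p p) ρ) :=
    isCompact_iff_compactSpace.1 (isCompact_closedBall _ _)
  set D : UnitTangentBundle n M → UnitTangentBundle n M → ℝ≥0∞ :=
    fun v w => ⨆ t, edist (Φ t v).1.proj (Φ t w).1.proj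
  obtain ⟨C, hC, hle⟩ := exists_le_of_eventually_le (fun a b => D (ψ a) (ψ b)) (by simp [D])
    (fun a b => by simp only [D, edist_comm])
    (fun a b c => iSup_le fun t => (edist_triangle _ (Φ t (ψ b)).1.proj _).trans
      (add_le_add (le_iSup (fun t => edist (Φ t (ψ a)).1.proj (Φ t (ψ b)).1.proj) t)
        (le_iSup (fun t => edist (Φ t (ψ b)).1.proj (Φ t (ψ c)).1.proj) t)))
    (fun a => by
      -- Any finite ε would do, since only boundedness of D is wanted.
      obtain ⟨δ, hδ, h⟩ := hequi (ψ a) 1 one_pos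
      filter_upwards [hψ.continuousAt.eventually (eventually_sasakiEDist_lt (ψ a) hδ)] with b hb
      exact iSup_le fun t => (edist_proj_le_sasakiEDist _ _).trans (h _ hb t).le)
  refine ⟨C, hC, hrange.mono fun x hx v w hv hw t => ?_⟩
  obtain ⟨a, rfl⟩ := hx v hv
  obtain ⟨b, rfl⟩ := hx w hw
  exact (le_iSup (fun t => edist (Φ t (ψ a)).1.proj (Φ t (ψ b)).1.proj) t).trans (hle a b)

/-- For r > 0 minimal geodesics show that the sphere lies in the image of the unit vectors at x
under v ↦ π Φ_r v, whose diameter is bounded by `exists_edist_flow_le`. For r ≤ 0 the sphere has at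
most one point. -/
theorem exists_ediam_sphere_le (hn : 2 ≤ n)
    {Φ : ℝ → UnitTangentBundle n M → UnitTangentBundle n M} (hΦ : IsGeodesicFlow Φ)
    (hequi : PointwiseEquicontinuous sasakiEDist Φ) (p : M) :
    ∃ C < ⊤, ∀ᶠ x in 𝓝 p, ∀ r, Metric.ediam (Metric.sphere x r) ≤ C := by
  obtain ⟨C, hC, h⟩ := exists_edist_flow_le hn hequi p
  refine ⟨C, hC, h.mono fun x hx r => Metric.ediam_le fun y hy z hz => ?_⟩
  choose Γ hΓ hΓ0 hΓΦ using hΦ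
  have hreach : ∀ y ∈ Metric.sphere x r, 0 < r → ∃ v : UnitTangentBundle n M, v.1.proj = x ∧
      (Φ r v).1.proj = y := by
    intro y hy hr
    rw [Metric.mem_sphere'] at hy
    obtain ⟨v, hv, hvy⟩ := exists_minimal_geodesic (fun v => ⟨hΓ v, hΓ0 v⟩)
      (dist_pos.1 (hy ▸ hr))
    refine ⟨v, hv, ?_⟩
    rw [hΓΦ, ← hy]
    exact hvy
  rcases le_or_gt r 0 with hr | hr
  · have hyx : y = x := dist_le_zero.1 (le_of_eq_of_le (Metric.mem_sphere.1 hy) hr)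
    have hzx : z = x := dist_le_zero.1 (le_of_eq_of_le (Metric.mem_sphere.1 hz) hr)
    rw [hyx, hzx, edist_self]
    exact zero_le
  · obtain ⟨v, hv, rfl⟩ := hreach y hy hr
    obtain ⟨w, hw, rfl⟩ := hreach z hz hr
    exact hx v w hv hw r

end Spheres

end RiemGeom

end

/-! ### Absence of lines and the diameter bound -/

theorem corollary6p4 (n : ℕ) (hn : 2 ≤ n)
    (M : Type*) [MetricSpace M] [ChartedSpace (EuclideanSpace ℝ (Fin n)) M]
    [IsManifold (𝓡 n) ∞ M] [RiemannianBundle (fun x : M => TangentSpace (𝓡 n) x)]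
    [IsContMDiffRiemannianBundle (𝓡 n) ∞ (EuclideanSpace ℝ (Fin n))
      (fun x : M => TangentSpace (𝓡 n) x)]
    [IsRiemannianManifold (𝓡 n) M] [ConnectedSpace M] [NoncompactSpace M]
    (Φ : ℝ → RiemGeom.UnitTangentBundle n M → RiemGeom.UnitTangentBundle n M)
    (hΦ : RiemGeom.IsGeodesicFlow Φ)
    (hequi : RiemGeom.PointwiseEquicontinuous RiemGeom.sasakiEDist Φ) :
    (¬ ∃ γ : ℝ → M, RiemGeom.IsLine n γ) ∧
    ∃ C : M → ℝ,
      (∀ (x : M) (r : ℝ), Metric.ediam (Metric.sphere x r) ≤ ENNReal.ofReal (C x)) ∧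
      ∀ K : Set M, IsCompact K → BddAbove (C '' K) := by
  have hloc := RiemGeom.exists_ediam_sphere_le hn hΦ hequi
  -- The least possible bound at x. It is finite by `hloc`, so `toReal` loses nothing.
  set C : M → ℝ := fun x => (⨆ r, Metric.ediam (Metric.sphere x r)).toReal
  have hC : ∀ (x : M) (r : ℝ), Metric.ediam (Metric.sphere x r) ≤ ENNReal.ofReal (C x) := by
    intro x r
    obtain ⟨B, hB, h⟩ := hloc x
    rw [ENNReal.ofReal_toReal ((iSup_le h.self_of_nhds).trans_lt hB).ne]
    exact le_iSup (fun r => Metric.ediam (Metric.sphere x r)) r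
  refine ⟨?_, C, hC, fun K hK => ?_⟩
  · rintro ⟨γ, -, hγ⟩
    have hC0 : 0 ≤ C (γ 0) := ENNReal.toReal_nonneg
    -- The points γ(r) and γ(-r) are 2r apart, and 2 (C + 1) > C because C ≥ 0.
    set r := C (γ 0) + 1 with hr
    have h1 : γ r ∈ Metric.sphere (γ 0) r := by
      rw [Metric.mem_sphere, hγ, sub_zero, abs_of_nonneg (by linarith)]
    have h2 : γ (-r) ∈ Metric.sphere (γ 0) r := by
      rw [Metric.mem_sphere, hγ, sub_zero, abs_neg, abs_of_nonneg (by linarith)]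
    have h3 := (Metric.edist_le_ediam_of_mem h1 h2).trans (hC (γ 0) r)
    rw [edist_dist, ENNReal.ofReal_le_ofReal_iff hC0, hγ, abs_of_nonneg (by linarith)] at h3
    linarith
  -- The bound is uniform near each point, and compactness reduces K to finitely many such
  -- neighbourhoods.
  · refine hK.induction_on (p := fun s => BddAbove (C '' s)) (by simp)
      (fun s t hst ht => ht.mono (image_mono hst)) (fun s t hs ht => ?_) fun x _ => ?_
    · rw [image_union]
      exact hs.union ht
    · obtain ⟨B, hB, h⟩ := hloc x
      refine ⟨_, mem_nhdsWithin_of_mem_nhds h, B.toReal, ?_⟩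
      rintro _ ⟨y, hy, rfl⟩
      exact ENNReal.toReal_mono hB.ne (iSup_le hy)
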